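/- **Setting.** Let $N,p\ge 1$ be integers ($N$ players with $p$-dimensional states), $T>0$, let $\Omega=\mathbb T^{N\times p}=(\mathbb R/\mathbb Z)^{N\times p}$ with coordinates $x_{jl}$ ($1\le j\le N$, $1\le l\le p$) and $|\Omega|=1$, and put $n=pN^2$. Components of vectors $v\in\mathbb R^n$ are indexed as $v_{ijl}$ with $1\le i,j\le N$, $1\le l\le p$, and entries of matrices $A\in\mathbb R^{n\times n}$ as $A_{ijk,hqr}$; $\mathbb R^{n\times n}_s$ denotes the symmetric matrices with the Frobenius scalar product. Let $X=L^2(\Omega)$, and let $(\cdot,\cdot)$ denote the integral over $\Omega$ of the pointwise scalar product of $\mathbb R^n$- or $\mathbb R^{n\times n}_s$-valued functions. For $A\in\mathbb R^{n\times n}_s$ and $1\le i\le N$ set $$(\mathfrak U A)_i=\frac12\sum_{l=1}^p\Big[A_{iil,iil}+\sum_{j\ne i}(A_{jjl,ijl}+A_{ijl,jjl})\Big],$$ and let $Lw=-\nabla(\mathfrak U w)$, that is, $(Lw)_{ijl}=-\partial_{x_{jl}}(\mathfrak U w)_i$. Let $\Pi v(x)=\int_\Omega v(y)\,dy$ (applied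 at each time when $v$ depends on $t$). Fix $v_0\in X^n$ and a base state $\bar v\in L^2((0,T)\times\Omega;\mathbb R^n)$. Consider pairs $$(E,B)\in L^2((0,T)\times\Omega;\mathbb R^n)\times L^\infty((0,T)\times\Omega;\mathbb R^{n\times n}_s)\tag{1}$$ subject to the linear constraint $$\int_0^T\big[(B,\partial_t\Psi)+(E,L\Psi)\big]\,dt=0\quad\text{for all smooth } \Psi:[0,T]\times\Omega\to\mathbb R^{n\times n}_s \text{ with } \Psi(0,\cdot)=0.\tag{2}$$ Put $\mathfrak C(\bar v,v_0)=\int_0^T[-(v_0,\bar v)+\frac12(\bar v,\bar v)]\,dt$ and define the dual value $$\mathcal J(v_0,\bar v,T)=\sup_{(E,B):\,(1),(2)}\ \inf_{v\in L^2((0,T)\times\Omega;\mathbb R^n)}\int_0^T\Big[(v-v_0,E-\bar v)+\tfrac12(v\otimes v,I+2B)\Big]dt+\mathfrak C(\bar v,v_0)\in[-\infty,+\infty].$$ For $(Q,B)\in L^2((0,T)\times\Omega;\mathbb R^n)\times L^\infty((0,T)\times\Omega;\mathbb R^{n\times n}_s)$ put $$\mathcal K(Q,B)=\inf_{z\otimes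 z\le M}\int_0^T\Big[(z,Q)+\tfrac12(M,I+2B)\Big]dt\in[-\infty,0],$$ where the infimum is over all $(z,M)\in L^2((0,T)\times\Omega;\mathbb R^n)\times L^1((0,T)\times\Omega;\mathbb R^{n\times n}_s)$ such that $M-z\otimes z$ is positive semidefinite a.e. The concave dual problem is to maximize $$\int_0^T\Big[-(v_0,E)+\tfrac12(\bar v,\bar v)\Big]dt+\mathcal K(E-\bar v,B)\tag{3}$$ over all pairs $(E,B)$ satisfying (1), (2) and $I+2B\ge0$ a.e. in $(0,T)\times\Omega$. **Theorem (Existence of a variational dual solution).** Assume that $N>1$. Then for any $v_0\in X^n$ and any $\bar v\in L^2((0,T)\times\Omega;\mathbb R^n)$ the concave dual problem has a maximizer $(E,B)$ in the class (1), the maximal value of (3) is $\mathcal J(v_0,\bar v,T)$, and $$\mathfrak C(\Pi\bar v,\Pi v_0)\le\mathcal J(v_0,\bar v,T)<+\infty.$$ -/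

import Mathlib

open MeasureTheory
open scoped ContDiff

noncomputable section

namespace NashDual

/-- The periodic box `𝕋^{N × p}`, with coordinates `x_{jl}`. Its volume is `1`. -/
abbrev Box (N p : ℕ) : Type := UnitAddTorus (Fin N × Fin p)

/-- The index set of the components `v_{ijl}`; it has `n = p N²` elements. -/
abbrev Idx (N p : ℕ) : Type := Fin N × Fin N × Fin p

/-- `ℝ^n` with its Euclidean structure. -/
abbrev Vec (N p : ℕ) : Type := EuclideanSpace ℝ (Idx N p)

/-- `ℝ^{n × n}`. -/
abbrev Mat (N p : ℕ) : Type := Matrix (Idx N p) (Idx N p) ℝ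

variable {N p : ℕ}

/-- The measure `dt dx` on `(0,T) × Ω`. -/
def cyl (N p : ℕ) (T : ℝ) : Measure (ℝ × Box N p) :=
  (volume.restrict (Set.Ioo 0 T)).prod volume

/-- The Frobenius scalar product. -/
def frob (A B : Mat N p) : ℝ := ∑ a, ∑ b, A a b * B a b

/-- `v ⊗ v`. -/
def tensorSq (v : Vec N p) : Mat N p := Matrix.of fun a b => v a * v b

/-- The linear operator `𝔘`, characterised by
`(𝔘 (∇ψ ⊗ ∇ψ))_i = ∑_l (½ |∂_{x_{il}} ψ_i|² + ∑_{j ≠ i} ∂_{x_{jl}} ψ_j ∂_{x_{jl}} ψ_i)`,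
where the component `(i, j, l)` of `∇ψ` is `∂_{x_{jl}} ψ_i`. -/
def opU (A : Mat N p) (i : Fin N) : ℝ :=
  (1 / 2) * ∑ l : Fin p, (A (i, i, l) (i, i, l) +
    ∑ j ∈ Finset.univ.erase i, (A (j, j, l) (i, j, l) + A (i, j, l) (j, j, l)))

/-- The partial derivative of `f : Ω → ℝ` at `x` in the direction of the coordinate `k`. -/
def pderiv (f : Box N p → ℝ) (k : Fin N × Fin p) (x : Box N p) : ℝ :=
  deriv (fun s : ℝ => f (x + Pi.single k (s : UnitAddCircle))) 0

/-- `L w = - ∇ (𝔘 w)`. -/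
def opL (w : Box N p → Mat N p) (x : Box N p) : Vec N p :=
  WithLp.toLp 2 fun a => - pderiv (fun y => opU (w y) a.1) a.2 x

/-- Smooth fields of symmetric matrices, periodic in space, that vanish at `t = 0`.
Smoothness up to `t = 0` and `t = T` is expressed by smoothness on the whole time axis. -/
structure IsTestField (Ψ : ℝ × Box N p → Mat N p) : Prop where
  smooth : ∀ a b, ContDiff ℝ ∞ fun q : ℝ × (Fin N × Fin p → ℝ) =>
    Ψ (q.1, fun k => (q.2 k : UnitAddCircle)) a b
  symm : ∀ z, (Ψ z).IsSymm
  initial : ∀ x, Ψ (0, x) = 0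

/-- The time derivative `∂_t Ψ`. -/
def timeDeriv (Ψ : ℝ × Box N p → Mat N p) (z : ℝ × Box N p) : Mat N p :=
  Matrix.of fun a b => deriv (fun s : ℝ => Ψ (s, z.2) a b) z.1

/-- The class `L²((0,T) × Ω; ℝ^n) × L^∞((0,T) × Ω; ℝ^{n × n}_s)`. -/
structure InDualClass (T : ℝ) (E : ℝ × Box N p → Vec N p) (B : ℝ × Box N p → Mat N p) :
    Prop where
  memLp_E : MemLp E 2 (cyl N p T)
  memLp_B : ∀ a b, MemLp (fun z => B z a b) ⊤ (cyl N p T)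
  symm_B : ∀ᵐ z ∂(cyl N p T), (B z).IsSymm

/-- The linear constraint `∫₀ᵀ [(B, ∂_t Ψ) + (E, L Ψ)] dt = 0` for all test fields `Ψ`. -/
def LinConstraint (T : ℝ) (E : ℝ × Box N p → Vec N p) (B : ℝ × Box N p → Mat N p) : Prop :=
  ∀ Ψ : ℝ × Box N p → Mat N p, IsTestField Ψ →
    ∫ z, (frob (B z) (timeDeriv Ψ z) + inner ℝ (E z) (opL (fun x => Ψ (z.1, x)) z.2))
      ∂(cyl N p T) = 0

/-- The pairs `(z, M) ∈ L² × L¹` with `M` symmetric and `z ⊗ z ≤ M` almost everywhere. -/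
structure IsMomentPair (T : ℝ) (z : ℝ × Box N p → Vec N p) (M : ℝ × Box N p → Mat N p) :
    Prop where
  memLp_z : MemLp z 2 (cyl N p T)
  memLp_M : ∀ a b, MemLp (fun w => M w a b) 1 (cyl N p T)
  symm_M : ∀ᵐ w ∂(cyl N p T), (M w).IsSymm
  le : ∀ᵐ w ∂(cyl N p T), (M w - tensorSq (z w)).PosSemidef

/-- `𝓚(Q, B) = inf_{z ⊗ z ≤ M} ∫₀ᵀ [(z, Q) + ½ (M, I + 2B)] dt`, possibly `-∞`. -/
def functionalK (T : ℝ) (Q : ℝ × Box N p → Vec N p) (B : ℝ × Box N p → Mat N p) : EReal :=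
  ⨅ (z : ℝ × Box N p → Vec N p) (M : ℝ × Box N p → Mat N p) (_ : IsMomentPair T z M),
    ((∫ w, (inner ℝ (z w) (Q w) + (1 / 2) * frob (M w) (1 + (2 : ℝ) • B w)) ∂(cyl N p T) : ℝ) :
      EReal)

/-- `ℭ(v̄, v₀) = ∫₀ᵀ [-(v₀, v̄) + ½ (v̄, v̄)] dt`. -/
def functionalC (T : ℝ) (vbar : ℝ × Box N p → Vec N p) (v0 : Box N p → Vec N p) : ℝ :=
  ∫ z, (- inner ℝ (v0 z.2) (vbar z) + (1 / 2) * inner ℝ (vbar z) (vbar z)) ∂(cyl N p T)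

/-- The dual value
`𝓙(v₀, v̄, T) = sup_{E,B} inf_v ∫₀ᵀ [(v - v₀, E - v̄) + ½ (v ⊗ v, I + 2B)] dt + ℭ(v̄, v₀)`. -/
def dualValue (T : ℝ) (v0 : Box N p → Vec N p) (vbar : ℝ × Box N p → Vec N p) : EReal :=
  ⨆ (E : ℝ × Box N p → Vec N p) (B : ℝ × Box N p → Mat N p)
    (_ : InDualClass T E B ∧ LinConstraint T E B),
    ((⨅ (v : ℝ × Box N p → Vec N p) (_ : MemLp v 2 (cyl N p T)),
      ((∫ z, (inner ℝ (v z - v0 z.2) (E z - vbar z) +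
        (1 / 2) * frob (tensorSq (v z)) (1 + (2 : ℝ) • B z)) ∂(cyl N p T) : ℝ) : EReal)) +
      (functionalC T vbar v0 : EReal))

/-- The competitors of the concave dual problem: pairs `(E, B)` in `L² × L^∞` that satisfy the
linear constraint and `I + 2B ≥ 0` almost everywhere. -/
structure IsAdmissible (T : ℝ) (E : ℝ × Box N p → Vec N p) (B : ℝ × Box N p → Mat N p) :
    Prop where
  inClass : InDualClass T E B
  constraint : LinConstraint T E B
  nonneg : ∀ᵐ z ∂(cyl N p T), (1 + (2 : ℝ) • B z).PosSemidef

/-- The objective `∫₀ᵀ [-(v₀, E) + ½ (v̄, v̄)] dt + 𝓚(E - v̄, B)` of the concave dual problem. -/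
def concaveObjective (T : ℝ) (v0 : Box N p → Vec N p) (vbar : ℝ × Box N p → Vec N p)
    (E : ℝ × Box N p → Vec N p) (B : ℝ × Box N p → Mat N p) : EReal :=
  ((∫ z, (- inner ℝ (v0 z.2) (E z) + (1 / 2) * inner ℝ (vbar z) (vbar z)) ∂(cyl N p T) : ℝ) :
    EReal) + functionalK T (fun z => E z - vbar z) B

/-- The maximizers of the concave dual problem. -/
structure IsDualMaximizer (T : ℝ) (v0 : Box N p → Vec N p) (vbar : ℝ × Box N p → Vec N p)
    (E : ℝ × Box N p → Vec N p) (B : ℝ × Box N p → Mat N p) : Prop where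
  admissible : IsAdmissible T E B
  isMax : ∀ E' B', IsAdmissible T E' B' →
    concaveObjective T v0 vbar E' B' ≤ concaveObjective T v0 vbar E B

/-- The averaging operator `Π`, on functions of `x`. -/
def avg (v : Box N p → Vec N p) (_x : Box N p) : Vec N p := ∫ y, v y

/-- The averaging operator `Π`, applied at each time to a function of `(t, x)`. -/
def avgT (v : ℝ × Box N p → Vec N p) (z : ℝ × Box N p) : Vec N p :=
  avg (fun y => v (z.1, y)) z.2

end NashDual

end

/-!
Both forms of the dual problem maximize the infimum over `v` of the same functional
`lagrangian T v0 vbar E B v`, in which the terms `(v₀, v̄)` of the two definitions cancel: for the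
dual value this is `le_dualTerm_iff`, and for the concave problem `le_concaveObjective_iff`, since
`M = z ⊗ z` is optimal in `𝓚` when `I + 2B ≥ 0`. A pair for which this infimum is finite satisfies
`I + 2B ≥ 0` (`ae_nonneg_of_le_lagrangian`), so it is enough to maximize over all pairs in the class.

Testing the linear constraint with fields that take values in the kernel of `𝔘` shows that
`B = 𝔘* b` for a function `b` with values in `ℝ^N` (`LinConstraint.ae_eq_opUadj`). For such `B`, the
inequality `I + 2B ≥ 0` yields `b_i² ≤ 1 + b_j` for `i ≠ j`, so that `b` is bounded as soon as there
are two players (`abs_le_of_posSemidef`). With `B` bounded, testing the Lagrangian with a small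
negative multiple of `E - v̄` bounds `E` in `L²` and the value from above (`coercivity`).

For bounded `v`, the Lagrangian is a continuous affine function of `(E, b)` in the Hilbert space
`L² × L²`, and the linear constraint is an orthogonality condition there. The superlevel sets of the
infimum over bounded `v` are therefore closed, convex and bounded, and a nested sequence of such sets
has a common point (`exists_maximin`). A truncation of `v` recovers the infimum over all `v ∈ L²`
(`le_lagrangian_of_top`). The pair `(Π v̄, 0)` is a competitor with value at least `ℭ(Π v̄, Π v₀)`
(`functionalC_le_lagrangian`), which gives the lower bound and the nonemptiness of a superlevel set.
-/

noncomputable section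

namespace NashDual

variable {N p : ℕ} {T : ℝ}

/-! ### The operator `𝔘`, its adjoint, and the Frobenius product -/

lemma frob_add_right (A B C : Mat N p) : frob A (B + C) = frob A B + frob A C := by
  simp [frob, mul_add, Finset.sum_add_distrib]

lemma frob_smul_right (r : ℝ) (A B : Mat N p) : frob A (r • B) = r * frob A B := by
  simp only [frob, Finset.mul_sum, Matrix.smul_apply, smul_eq_mul]
  exact Finset.sum_congr rfl fun _ _ => Finset.sum_congr rfl fun _ _ => by ring

lemma frob_comm (A B : Mat N p) : frob A B = frob B A := by
  simp [frob, mul_comm]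

lemma frob_sub_left (A B C : Mat N p) : frob (A - B) C = frob A C - frob B C := by
  simp [frob, sub_mul, Finset.sum_sub_distrib]

lemma frob_tensorSq_one (v : Vec N p) : frob (tensorSq v) 1 = ‖v‖ ^ 2 := by
  rw [EuclideanSpace.norm_sq_eq]
  simp [frob, tensorSq, Matrix.one_apply, sq]

lemma frob_tensorSq_perturbed (v : Vec N p) (B : Mat N p) :
    frob (tensorSq v) (1 + (2 : ℝ) • B) = ‖v‖ ^ 2 + 2 * frob B (tensorSq v) := by
  rw [frob_add_right, frob_smul_right, frob_tensorSq_one, frob_comm]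

lemma frob_tensorSq (v : Vec N p) (S : Mat N p) :
    frob (tensorSq v) S = (v : Idx N p → ℝ) ⬝ᵥ S.mulVec v := by
  simp only [frob, tensorSq, dotProduct, Matrix.mulVec, Matrix.of_apply, Finset.mul_sum]
  exact Finset.sum_congr rfl fun _ _ => Finset.sum_congr rfl fun _ _ => by ring

lemma posSemidef_iff_frob {S : Mat N p} (hS : S.IsSymm) :
    S.PosSemidef ↔ ∀ v : Vec N p, 0 ≤ frob (tensorSq v) S := by
  rw [Matrix.posSemidef_iff_dotProduct_mulVec]
  constructor
  · intro h v
    rw [frob_tensorSq]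
    simpa using h.2 (v : Idx N p → ℝ)
  · refine fun h => ⟨by
      rwa [Matrix.IsHermitian, Matrix.conjTranspose_eq_transpose_of_trivial], fun x => ?_⟩
    have := h (WithLp.toLp 2 x)
    rw [frob_tensorSq] at this
    simpa using this

/-- The Frobenius product of two positive semidefinite matrices is nonnegative. -/
lemma frob_nonneg_of_posSemidef {P S : Mat N p} (hP : P.PosSemidef) (hS : S.PosSemidef) :
    0 ≤ frob P S := by
  obtain ⟨C, rfl⟩ : ∃ C : Mat N p, P = C.conjTranspose * C := by
    open scoped MatrixOrder in
    exact CStarAlgebra.nonneg_iff_eq_star_mul_self.mp hP.nonneg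
  have : frob (C.conjTranspose * C) S = ∑ k, frob (tensorSq (WithLp.toLp 2 (C k))) S := by
    simp only [frob, tensorSq, Matrix.mul_apply, Finset.sum_mul, Matrix.of_apply,
      Matrix.conjTranspose_apply, star_trivial]
    rw [Finset.sum_comm' (t' := Finset.univ) (s' := fun _ => Finset.univ) (by simp)]
    rw [Finset.sum_comm]
    conv_rhs => rw [Finset.sum_comm]
    refine Finset.sum_congr rfl fun a _ => ?_
    rw [Finset.sum_comm]
  rw [this]
  refine Finset.sum_nonneg fun k _ => ?_
  have hsymm : S.IsSymm := by
    have h := hS.1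
    rwa [Matrix.IsHermitian, Matrix.conjTranspose_eq_transpose_of_trivial] at h
  exact (posSemidef_iff_frob hsymm).1 hS _

lemma opU_add (A B : Mat N p) (i : Fin N) : opU (A + B) i = opU A i + opU B i := by
  simp only [opU, Matrix.add_apply, ← mul_add, ← Finset.sum_add_distrib]
  congr 1
  refine Finset.sum_congr rfl fun l _ => ?_
  rw [add_add_add_comm, ← Finset.sum_add_distrib]
  congr 1
  exact Finset.sum_congr rfl fun _ _ => by ring

lemma opU_smul (r : ℝ) (A : Mat N p) (i : Fin N) : opU (r • A) i = r * opU A i := by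
  simp only [opU, Matrix.smul_apply, smul_eq_mul, ← mul_add, ← Finset.mul_sum]
  ring

/-- The component `A ↦ (𝔘 A)_i` as a linear form. -/
def opULin (i : Fin N) : Mat N p →ₗ[ℝ] ℝ where
  toFun A := opU A i
  map_add' A B := opU_add A B i
  map_smul' r A := opU_smul r A i

@[simp] lemma opULin_apply (i : Fin N) (A : Mat N p) : opULin i A = opU A i := rfl

lemma opU_transpose (A : Mat N p) (i : Fin N) : opU A.transpose i = opU A i := by
  simp [opU, Matrix.transpose_apply, add_comm]

/-- The symmetric matrix `½ (e_a ⊗ e_c + e_c ⊗ e_a)`. -/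
def symUnit (a c : Idx N p) : Mat N p :=
  (1 / 2 : ℝ) • (Matrix.single a c 1 + Matrix.single c a 1)

lemma symUnit_comm (a c : Idx N p) : symUnit a c = symUnit c a := by
  rw [symUnit, symUnit, add_comm]

lemma isSymm_symUnit (a c : Idx N p) : (symUnit a c).IsSymm := by
  simp [Matrix.IsSymm, symUnit, Matrix.transpose_add, add_comm]

lemma frob_symUnit {B : Mat N p} (hB : B.IsSymm) (a c : Idx N p) : frob B (symUnit a c) = B a c := by
  have h : ∀ a c : Idx N p, frob B (Matrix.single a c 1) = B a c := fun a c => by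
    simp [frob, Matrix.single_apply, ite_and]
  rw [symUnit, frob_smul_right, frob_add_right, h, h, hB.apply]
  ring

/-- The adjoint `𝔘*` of `𝔘`, with values in the symmetric matrices. -/
def opUadj (b : Fin N → ℝ) : Mat N p :=
  Matrix.of fun a c => ∑ i, b i * opU (symUnit a c) i

lemma isSymm_opUadj (b : Fin N → ℝ) : (opUadj b : Mat N p).IsSymm := by
  ext a c
  simp [opUadj, symUnit_comm a c]

lemma opU_eq_sum (A : Mat N p) (i : Fin N) :
    opU A i = ∑ a, ∑ c, A a c * opU (symUnit a c) i := by
  have h1 : (∑ a, ∑ c, A a c • symUnit a c : Mat N p) = (1 / 2 : ℝ) • (A + A.transpose) := by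
    simp only [symUnit, smul_comm (_ : ℝ) (1 / 2 : ℝ), ← Finset.smul_sum, smul_add,
      Finset.sum_add_distrib]
    congr 1
    · congr 1
      conv_rhs => rw [Matrix.matrix_eq_sum_single A]
      simp
    · congr 1
      conv_rhs => rw [Matrix.matrix_eq_sum_single A.transpose]
      rw [Finset.sum_comm]
      simp
  have h2 : opULin i (∑ a, ∑ c, A a c • symUnit a c : Mat N p) = opU A i := by
    rw [h1, opULin_apply, opU_smul, opU_add, opU_transpose]
    ring
  rw [← h2]
  simp only [map_sum, map_smul, opULin_apply, smul_eq_mul]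

lemma frob_opUadj (b : Fin N → ℝ) (A : Mat N p) : frob (opUadj b) A = ∑ i, b i * opU A i := by
  simp only [frob, opUadj, Matrix.of_apply, opU_eq_sum A, Finset.mul_sum, Finset.sum_mul]
  conv_rhs => rw [Finset.sum_comm]
  refine Finset.sum_congr rfl fun a _ => ?_
  rw [Finset.sum_comm]
  conv_rhs => rw [Finset.sum_comm]
  rw [Finset.sum_comm]
  exact Finset.sum_congr rfl fun _ _ => Finset.sum_congr rfl fun _ _ => by ring

/-- The unit matrix at a diagonal entry `(i, i, l)`, scaled so that `𝔘` maps it to `e_i`. -/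
def dualUnit (l : Fin p) (i : Fin N) : Mat N p := (2 : ℝ) • symUnit (i, i, l) (i, i, l)

lemma isSymm_dualUnit (l : Fin p) (i : Fin N) : (dualUnit l i : Mat N p).IsSymm :=
  (isSymm_symUnit _ _).smul _

lemma opU_dualUnit (l : Fin p) (i k : Fin N) :
    opU (dualUnit l i) k = if k = i then 1 else 0 := by
  have h1 : opU (dualUnit l i) k =
      (1 / 2) * ∑ m : Fin p, if k = i ∧ m = l then 2 else (0 : ℝ) := by
    simp only [opU]
    congr 1
    refine Finset.sum_congr rfl fun m _ => ?_
    rw [Finset.sum_eq_zero]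
    · simp only [dualUnit, symUnit, Matrix.smul_apply, Matrix.add_apply, Matrix.single_apply,
        Prod.mk.injEq, smul_eq_mul]
      by_cases hk : i = k <;> by_cases hm : l = m <;>
        simp [hk, hm, eq_comm (a := k), eq_comm (a := m)]
      norm_num
    · intro j hj
      have hj' : j ≠ k := (Finset.mem_erase.1 hj).1
      simp only [dualUnit, symUnit, Matrix.smul_apply, Matrix.add_apply, Matrix.single_apply,
        Prod.mk.injEq, smul_eq_mul]
      by_cases hk : i = k
      · simp [hk, hj'.symm]
      · simp [hk]
  rw [h1]
  by_cases hk : k = i <;> simp [hk]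

/-- A matrix orthogonal to `symUnit a c - ∑ i, (𝔘 (symUnit a c))_i dualUnit l i` for all `a`, `c`
(these span the kernel of `𝔘`) lies in the range of `𝔘*`. -/
lemma eq_opUadj_of_orthogonal {B : Mat N p} (hB : B.IsSymm) (l : Fin p)
    (h : ∀ a c, frob B (symUnit a c - ∑ i, opU (symUnit a c) i • dualUnit l i) = 0) :
    B = opUadj fun i => 2 * B (i, i, l) (i, i, l) := by
  ext a c
  have h1 := h a c
  -- The additivity of `frob B` over the subtracted sum.
  have hlin : ∀ (s : Finset (Fin N)) (A : Mat N p) (f : Fin N → ℝ),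
      frob B (A - ∑ i ∈ s, f i • dualUnit l i) =
        frob B A - ∑ i ∈ s, f i * frob B (dualUnit l i) := by
    intro s A f
    induction s using Finset.induction_on generalizing A with
    | empty => simp
    | insert i s hi ih =>
      rw [Finset.sum_insert hi, Finset.sum_insert hi, add_comm, ← sub_sub, sub_eq_add_neg,
        frob_add_right, ih, ← neg_smul, frob_smul_right]
      ring
  rw [hlin, frob_symUnit hB, sub_eq_zero] at h1
  rw [h1, opUadj, Matrix.of_apply]
  refine Finset.sum_congr rfl fun i _ => ?_
  rw [dualUnit, frob_smul_right, frob_symUnit hB]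
  ring

lemma opU_orthogonal_eq_zero (l : Fin p) (A : Mat N p) (k : Fin N) :
    opU (A - ∑ i, opU A i • dualUnit l i) k = 0 := by
  rw [← opULin_apply, map_sub, map_sum]
  simp [opU_dualUnit]

/-- The quadratic form of `I + 2 𝔘* b` at `e_{jjl} - b_i e_{ijl}` equals `1 + b_j - b_i²`. -/
lemma sq_le_of_posSemidef {b : Fin N → ℝ} (l : Fin p) {i j : Fin N} (hij : i ≠ j)
    (h : ∀ v : Vec N p, 0 ≤ frob (tensorSq v) (1 + (2 : ℝ) • opUadj b)) :
    b i ^ 2 ≤ 1 + b j := by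
  have h1 := h (EuclideanSpace.single (j, j, l) 1 - b i • EuclideanSpace.single (i, j, l) 1)
  set u : Vec N p := EuclideanSpace.single (j, j, l) 1 - b i • EuclideanSpace.single (i, j, l) 1
    with hu
  have hu_apply : ∀ a m q, u (a, m, q) =
      if m = j ∧ q = l then (if a = j then 1 else if a = i then - b i else 0) else 0 := by
    intro a m q
    by_cases ha : a = j
    · subst ha
      by_cases hm : m = a <;> by_cases hq : q = l <;> simp [hu, hm, hq, hij.symm]
    · by_cases ha' : a = i <;> by_cases hm : m = j <;> by_cases hq : q = l <;>
        simp [hu, ha, ha', hm, hq, hij]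
  have hnorm : ‖u‖ ^ 2 = 1 + b i ^ 2 := by
    have hperp : inner ℝ (EuclideanSpace.single (j, j, l) (1 : ℝ) : Vec N p)
        (b i • EuclideanSpace.single (i, j, l) 1) = 0 := by
      rw [inner_smul_right]
      simp [EuclideanSpace.inner_single_left, hij.symm]
    rw [hu, norm_sub_sq_real, hperp, norm_smul]
    simp
  have hU : ∀ k, opU (tensorSq u) k = if k = j then 1 / 2 else if k = i then - b i else 0 := by
    intro k
    have h2 : opU (tensorSq u) k = (1 / 2) * ∑ m : Fin p,
        if m = l then (if k = j then 1 else if k = i then - 2 * b i else 0) else (0 : ℝ) := by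
      simp only [opU, tensorSq, Matrix.of_apply, hu_apply]
      congr 1
      refine Finset.sum_congr rfl fun m _ => ?_
      by_cases hm : m = l
      · simp only [hm, and_true, if_true]
        by_cases hk : k = j
        · rw [Finset.sum_eq_zero]
          · simp [hk]
          · intro x hx
            have hx' : x ≠ j := hk ▸ (Finset.mem_erase.1 hx).1
            simp [hx']
        · rw [Finset.sum_eq_single j]
          · by_cases hk' : k = i
            · simp [hk', hij]; ring
            · simp [hk, hk']
          · intro x _ hx
            simp [hx]
          · intro hj
            exact absurd (Finset.mem_erase.2 ⟨Ne.symm hk, Finset.mem_univ _⟩) hj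
      · simp [hm]
    rw [h2]
    by_cases hk : k = j <;> by_cases hk' : k = i <;> simp [hk, hk', hij]
  have hsum : ∑ k, b k * opU (tensorSq u) k = b j / 2 - b i ^ 2 := by
    have : ∀ k, b k * opU (tensorSq u) k =
        (if k = j then b k / 2 else 0) + if k = i then - b k ^ 2 else 0 := by
      intro k
      rw [hU]
      by_cases hk : k = j
      · simp [hk, hij.symm]; ring
      · by_cases hk' : k = i
        · simp [hk', hij]; ring
        · simp [hk, hk']
    simp only [this, Finset.sum_add_distrib]
    simp; ring
  rw [frob_tensorSq_perturbed, frob_opUadj, hnorm, hsum] at h1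
  linarith

/-- With at least two players, positivity of `I + 2 𝔘* b` bounds `b`. -/
lemma abs_le_of_posSemidef (hN : 1 < N) (l : Fin p) {b : Fin N → ℝ}
    (h : ∀ v : Vec N p, 0 ≤ frob (tensorSq v) (1 + (2 : ℝ) • opUadj b)) (i : Fin N) :
    |b i| ≤ 3 := by
  have : Nontrivial (Fin N) := Fin.nontrivial_iff_two_le.2 hN
  obtain ⟨j, hj⟩ := exists_ne i
  have h1 := sq_le_of_posSemidef l hj h
  have h2 := sq_le_of_posSemidef l hj.symm h
  rw [abs_le]
  constructor <;> nlinarith [sq_nonneg (b j - 1 / 2), sq_nonneg (b i - 1 / 2)]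

lemma abs_apply_le_norm (v : Vec N p) (a : Idx N p) : |v a| ≤ ‖v‖ := by
  simpa using PiLp.norm_apply_le v a

lemma abs_opU_tensorSq_le (v : Vec N p) (i : Fin N) :
    |opU (tensorSq v) i| ≤ p * (N + 1) * ‖v‖ ^ 2 := by
  have hE : ∀ a c, |tensorSq v a c| ≤ ‖v‖ ^ 2 := fun a c => by
    rw [tensorSq, Matrix.of_apply, abs_mul, sq]
    exact mul_le_mul (abs_apply_le_norm v a) (abs_apply_le_norm v c) (abs_nonneg _) (norm_nonneg _)
  have h1 : ∀ l : Fin p, |tensorSq v (i, i, l) (i, i, l) + ∑ j ∈ Finset.univ.erase i,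
      (tensorSq v (j, j, l) (i, j, l) + tensorSq v (i, j, l) (j, j, l))| ≤
      2 * (N + 1) * ‖v‖ ^ 2 := by
    intro l
    refine (abs_add_le _ _).trans ?_
    have h2 := (Finset.abs_sum_le_sum_abs (fun j =>
      (tensorSq v (j, j, l) (i, j, l) + tensorSq v (i, j, l) (j, j, l)))
      (Finset.univ.erase i)).trans (Finset.sum_le_card_nsmul _ _ (2 * ‖v‖ ^ 2) fun j _ => by
        refine (abs_add_le _ _).trans ?_
        linarith [hE (j, j, l) (i, j, l), hE (i, j, l) (j, j, l)])
    have h3 : ((Finset.univ.erase i).card : ℝ) ≤ N := by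
      exact_mod_cast (Finset.card_le_univ _).trans (by simp)
    have h4 := hE (i, i, l) (i, i, l)
    rw [nsmul_eq_mul] at h2
    have h5 := mul_le_mul_of_nonneg_right h3 (by positivity : (0 : ℝ) ≤ 2 * ‖v‖ ^ 2)
    have : (0 : ℝ) ≤ ‖v‖ ^ 2 := by positivity
    linarith
  rw [opU, abs_mul]
  have h6 := (Finset.abs_sum_le_sum_abs _ Finset.univ).trans
    (Finset.sum_le_card_nsmul Finset.univ _ _ fun l _ => h1 l)
  rw [nsmul_eq_mul] at h6
  simp only [Finset.card_univ, Fintype.card_fin] at h6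
  rw [abs_of_pos (by norm_num : (0 : ℝ) < 1 / 2)]
  linarith

/-! ### Maximizing an infimum of affine functions on a Hilbert space -/

open Filter Topology in
/-- In a Hilbert space, a decreasing sequence of nonempty bounded closed convex sets has a common
point: the points of minimal norm form a Cauchy sequence by the parallelogram identity. -/
lemma exists_mem_iInter_of_convex {H : Type*} [NormedAddCommGroup H] [InnerProductSpace ℝ H]
    [CompleteSpace H] {C : ℕ → Set H} (hanti : Antitone C) (hne : ∀ n, (C n).Nonempty)
    (hclosed : ∀ n, IsClosed (C n)) (hconv : ∀ n, Convex ℝ (C n)) {R : ℝ}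
    (hbdd : ∀ x ∈ C 0, ‖x‖ ≤ R) : ∃ x, ∀ n, x ∈ C n := by
  have hmin : ∀ n, ∃ x ∈ C n, ∀ y ∈ C n, ‖x‖ ≤ ‖y‖ := by
    intro n
    obtain ⟨x, hx, h⟩ := exists_norm_eq_iInf_of_complete_convex (hne n)
      (hclosed n).isComplete (hconv n) 0
    refine ⟨x, hx, fun y hy => ?_⟩
    have h1 : ‖(0 : H) - x‖ ≤ ‖(0 : H) - y‖ :=
      h.le.trans (ciInf_le ⟨0, by rintro _ ⟨w, rfl⟩; exact norm_nonneg _⟩ (⟨y, hy⟩ : C n))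
    simpa using h1
  choose x hx hxmin using hmin
  have hmono : Monotone fun n => ‖x n‖ := fun m n hmn => hxmin m _ (hanti hmn (hx n))
  have hbound : BddAbove (Set.range fun n => ‖x n‖) :=
    ⟨R, by rintro _ ⟨n, rfl⟩; exact hbdd _ (hanti (Nat.zero_le n) (hx n))⟩
  have hlim := tendsto_atTop_ciSup hmono hbound
  set s := ⨆ n, ‖x n‖
  have hle : ∀ n, ‖x n‖ ≤ s := fun n => le_ciSup hbound n
  have hsq : Tendsto (fun n => 2 * s ^ 2 + 2 * s ^ 2 - 4 * ‖x n‖ ^ 2) atTop (𝓝 0) := by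
    have := (tendsto_const_nhds (x := 2 * s ^ 2 + 2 * s ^ 2)).sub ((hlim.pow 2).const_mul 4)
    convert this using 2
    ring
  have hpar : ∀ m n, m ≤ n → ‖x n - x m‖ ^ 2 ≤ 2 * s ^ 2 + 2 * s ^ 2 - 4 * ‖x m‖ ^ 2 := by
    intro m n hmn
    have hmid : ‖x m‖ ≤ ‖(1 / 2 : ℝ) • x n + (1 / 2 : ℝ) • x m‖ :=
      hxmin m _ (hconv m (hanti hmn (hx n)) (hx m) (by norm_num) (by norm_num) (by norm_num))
    rw [← smul_add, norm_smul, Real.norm_of_nonneg (by norm_num : (0 : ℝ) ≤ 1 / 2)] at hmid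
    have h1 := parallelogram_law_with_norm ℝ (x n) (x m)
    nlinarith [norm_nonneg (x m), norm_nonneg (x n), hle m, hle n, norm_nonneg (x n + x m)]
  have hcauchy : CauchySeq x := by
    rw [Metric.cauchySeq_iff']
    intro ε hε
    obtain ⟨m, hm⟩ := (hsq.eventually (gt_mem_nhds (by positivity : (0 : ℝ) < ε ^ 2))).exists
    refine ⟨m, fun n hn => ?_⟩
    rw [dist_eq_norm]
    exact lt_of_pow_lt_pow_left₀ 2 hε.le ((hpar m n hn).trans_lt hm)
  obtain ⟨y, hy⟩ := cauchySeq_tendsto_of_complete hcauchy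
  exact ⟨y, fun n => (hclosed n).mem_of_tendsto hy
    (eventually_atTop.2 ⟨n, fun m hm => hanti hm (hx m)⟩)⟩

/-- The maximum of an infimum of continuous affine functions on a closed subspace of a Hilbert space
is attained, provided the superlevel sets are bounded in the stated quantitative way. -/
lemma exists_maximin {H ι κ : Type*} [NormedAddCommGroup H] [InnerProductSpace ℝ H]
    [CompleteSpace H] (g : κ → H) (α : ι → ℝ) (h : ι → H) {k R : ℝ} (hk : 0 < k)
    (hcoer : ∀ x, (∀ j, inner ℝ (g j) x = 0) → ∀ c, (∀ i, c ≤ α i + inner ℝ (h i) x) →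
      ‖x‖ ^ 2 + k * c ≤ R)
    {x₀ : H} {c₀ : ℝ} (hx₀ : ∀ j, inner ℝ (g j) x₀ = 0)
    (hc₀ : ∀ i, c₀ ≤ α i + inner ℝ (h i) x₀) :
    ∃ (x : H) (c : ℝ), (∀ j, inner ℝ (g j) x = 0) ∧ (∀ i, c ≤ α i + inner ℝ (h i) x) ∧
      ∀ y, (∀ j, inner ℝ (g j) y = 0) → ∀ d, (∀ i, d ≤ α i + inner ℝ (h i) y) → d ≤ c := by
  set S : ℝ → Set H := fun c =>
    {x | (∀ j, inner ℝ (g j) x = 0) ∧ ∀ i, c ≤ α i + inner ℝ (h i) x}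
  set G : Set ℝ := {c | (S c).Nonempty}
  have hGne : G.Nonempty := ⟨c₀, x₀, hx₀, hc₀⟩
  have hGbdd : BddAbove G := by
    refine ⟨R / k, ?_⟩
    rintro c ⟨x, hx, hxc⟩
    rw [le_div_iff₀ hk]
    nlinarith [hcoer x hx c hxc, sq_nonneg ‖x‖]
  have hSanti : Antitone S := fun c d hcd x hx => ⟨hx.1, fun i => hcd.trans (hx.2 i)⟩
  have hSclosed : ∀ c, IsClosed (S c) := by
    intro c
    have : S c = (⋂ j, {x | inner ℝ (g j) x = 0}) ∩ ⋂ i, {x | c ≤ α i + inner ℝ (h i) x} := by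
      ext x; simp [S]
    rw [this]
    exact (isClosed_iInter fun j => isClosed_eq (by fun_prop) continuous_const).inter
      (isClosed_iInter fun i => isClosed_le continuous_const (by fun_prop))
  have hSconv : ∀ c, Convex ℝ (S c) := by
    intro c x hx y hy a b ha hb hab
    refine ⟨fun j => ?_, fun i => ?_⟩
    · rw [inner_add_right, inner_smul_right, inner_smul_right, hx.1 j, hy.1 j]
      ring
    · rw [inner_add_right, inner_smul_right, inner_smul_right]
      have h1 := mul_le_mul_of_nonneg_left (hx.2 i) ha
      have h2 := mul_le_mul_of_nonneg_left (hy.2 i) hb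
      have h3 : c = a * c + b * c := by rw [← add_mul, hab, one_mul]
      have h4 : α i = a * α i + b * α i := by rw [← add_mul, hab, one_mul]
      linarith
  set c' := sSup G
  set d : ℕ → ℝ := fun n => c' - 1 / ((n : ℝ) + 1)
  have hd : Monotone d := fun m n hmn => by
    have := Nat.one_div_le_one_div (α := ℝ) hmn
    simp only [d]; linarith
  obtain ⟨x, hx⟩ := exists_mem_iInter_of_convex (C := fun n => S (d n)) (R := |R - k * d 0| + 1)
    (fun m n hmn => hSanti (hd hmn))
    (fun n => by
      obtain ⟨e, ⟨x, hx⟩, he⟩ := exists_lt_of_lt_csSup hGne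
        (show d n < c' from sub_lt_self _ Nat.one_div_pos_of_nat)
      exact ⟨x, hSanti he.le hx⟩)
    (fun n => hSclosed _) (fun n => hSconv _)
    (fun x hx => by
      have h1 := hcoer x hx.1 _ hx.2
      have h2 := le_abs_self (R - k * d 0)
      nlinarith [abs_nonneg (R - k * d 0), norm_nonneg x])
  refine ⟨x, c', (hx 0).1, fun i => ?_, fun y hy e he => le_csSup hGbdd ⟨y, hy, he⟩⟩
  refine le_of_forall_sub_le fun ε hε => ?_
  obtain ⟨n, hn⟩ := exists_nat_one_div_lt hε
  have := (hx n).2 i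
  simp only [d] at this
  linarith

/-! ### Calculus on the torus -/

instance isProbabilityMeasure_unitAddCircle :
    IsProbabilityMeasure (volume : Measure UnitAddCircle) := ⟨UnitAddCircle.measure_univ⟩

instance isFiniteMeasure_cyl (T : ℝ) : IsFiniteMeasure (cyl N p T) := by
  unfold cyl; infer_instance

/-- The covering map `ℝ^{N × p} → Ω`. -/
def toBox (y : Fin N × Fin p → ℝ) : Box N p := fun k => (y k : UnitAddCircle)

lemma isOpenQuotientMap_toBox : IsOpenQuotientMap (toBox : (Fin N × Fin p → ℝ) → Box N p) :=
  IsOpenQuotientMap.piMap fun _ => QuotientAddGroup.isOpenQuotientMap_mk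

lemma isOpenQuotientMap_prodMap_toBox :
    IsOpenQuotientMap (Prod.map id toBox : ℝ × (Fin N × Fin p → ℝ) → ℝ × Box N p) :=
  IsOpenQuotientMap.id.prodMap isOpenQuotientMap_toBox

lemma toBox_add_single (y : Fin N × Fin p → ℝ) (k : Fin N × Fin p) (s : ℝ) :
    toBox y + Pi.single k (s : UnitAddCircle) = toBox (y + s • Pi.single k 1) := by
  ext j
  by_cases h : j = k
  · subst h; simp [toBox]
  · simp [toBox, h]

/-- A function of time and of a point of the torus is smooth if its lift to `ℝ × ℝ^{N × p}` is. -/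
def SmoothLift (f : ℝ × Box N p → ℝ) : Prop :=
  ContDiff ℝ ∞ fun q : ℝ × (Fin N × Fin p → ℝ) => f (q.1, toBox q.2)

namespace SmoothLift
variable {f : ℝ × Box N p → ℝ}

lemma continuous_deriv (hf : SmoothLift f) :
    Continuous fun z : ℝ × Box N p => deriv (fun s => f (s, z.2)) z.1 := by
  rw [isOpenQuotientMap_prodMap_toBox.isQuotientMap.continuous_iff]
  have h : ∀ q : ℝ × (Fin N × Fin p → ℝ), deriv (fun s => f (s, toBox q.2)) q.1 =
      fderiv ℝ (fun q : ℝ × (Fin N × Fin p → ℝ) => f (q.1, toBox q.2)) q (1, 0) := by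
    intro q
    have h1 := (hf.differentiable (by simp) q).hasFDerivAt
    have h2 : HasDerivAt (fun s : ℝ => (s, q.2)) ((1 : ℝ), (0 : Fin N × Fin p → ℝ)) q.1 :=
      (hasDerivAt_id _).prodMk (hasDerivAt_const _ _)
    exact (h1.comp_hasDerivAt (f := fun s : ℝ => (s, q.2)) q.1 h2).deriv
  have h3 := (hf.continuous_fderiv (by simp)).clm_apply
    (continuous_const (y := ((1 : ℝ), (0 : Fin N × Fin p → ℝ))))
  exact h3.congr fun q => (h q).symm

lemma hasDerivAt_toBox (hf : SmoothLift f) (k : Fin N × Fin p) (t : ℝ) (y : Fin N × Fin p → ℝ)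
    (s : ℝ) : HasDerivAt (fun s : ℝ => f (t, toBox y + Pi.single k (s : UnitAddCircle)))
      (fderiv ℝ (fun q : ℝ × (Fin N × Fin p → ℝ) => f (q.1, toBox q.2))
        (t, y + s • Pi.single k 1) (0, Pi.single k 1)) s := by
  simp only [toBox_add_single]
  have h1 := (hf.differentiable (by simp) (t, y + s • Pi.single k 1)).hasFDerivAt
  have h2 : HasDerivAt (fun s : ℝ => (t, y + s • (Pi.single k 1 : Fin N × Fin p → ℝ)))
      ((0 : ℝ), (Pi.single k 1 : Fin N × Fin p → ℝ)) s := by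
    refine (hasDerivAt_const _ _).prodMk ?_
    simpa using ((hasDerivAt_id s).smul_const (Pi.single k 1 : Fin N × Fin p → ℝ)).const_add y
  exact h1.comp_hasDerivAt (f := fun s : ℝ => (t, y + s • (Pi.single k 1 : Fin N × Fin p → ℝ))) s h2

lemma pderiv_toBox (hf : SmoothLift f) (k : Fin N × Fin p) (t : ℝ) (y : Fin N × Fin p → ℝ) :
    pderiv (fun x => f (t, x)) k (toBox y) =
      fderiv ℝ (fun q : ℝ × (Fin N × Fin p → ℝ) => f (q.1, toBox q.2)) (t, y)
        (0, Pi.single k 1) := by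
  have := (hf.hasDerivAt_toBox k t y 0).deriv
  simpa [pderiv] using this

lemma continuous_pderiv (hf : SmoothLift f) (k : Fin N × Fin p) :
    Continuous fun z : ℝ × Box N p => pderiv (fun x => f (z.1, x)) k z.2 := by
  rw [isOpenQuotientMap_prodMap_toBox.isQuotientMap.continuous_iff]
  have h3 := (hf.continuous_fderiv (by simp)).clm_apply
    (continuous_const (y := ((0 : ℝ), (Pi.single k 1 : Fin N × Fin p → ℝ))))
  exact h3.congr fun q => (hf.pderiv_toBox k q.1 q.2).symm

lemma continuous (hf : SmoothLift f) : Continuous f := by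
  rw [isOpenQuotientMap_prodMap_toBox.isQuotientMap.continuous_iff]
  exact ContDiff.continuous hf

lemma hasDerivAt_pderiv (hf : SmoothLift f) (k : Fin N × Fin p) (t : ℝ) (x : Box N p) (s : ℝ) :
    HasDerivAt (fun s : ℝ => f (t, x + Pi.single k (s : UnitAddCircle)))
      (pderiv (fun x => f (t, x)) k (x + Pi.single k (s : UnitAddCircle))) s := by
  obtain ⟨y, rfl⟩ := isOpenQuotientMap_toBox.surjective x
  rw [toBox_add_single, hf.pderiv_toBox]
  exact hf.hasDerivAt_toBox k t y s

/-- The integral of a partial derivative over the torus vanishes, by translation invariance. -/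
lemma integral_pderiv (hf : SmoothLift f) (k : Fin N × Fin p) (t : ℝ) :
    ∫ x, pderiv (fun x => f (t, x)) k x = 0 := by
  have hcont : Continuous fun x => pderiv (fun x => f (t, x)) k x :=
    (hf.continuous_pderiv k).comp (Continuous.prodMk_right t)
  obtain ⟨C, hC⟩ := isCompact_univ.exists_bound_of_continuousOn hcont.continuousOn
  have hf' : Continuous fun x => f (t, x) := hf.continuous.comp (Continuous.prodMk_right t)
  have hshift : ∀ c : Box N p, Continuous fun x : Box N p => x + c :=
    fun c => continuous_add_const c
  have hmeas : ∀ s : ℝ, AEStronglyMeasurable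
      (fun x : Box N p => f (t, x + Pi.single k (s : UnitAddCircle))) volume :=
    fun s => Continuous.aestronglyMeasurable (hf'.comp (hshift _))
  have hint : Integrable (fun x : Box N p => f (t, x + Pi.single k ((0 : ℝ) : UnitAddCircle))) := by
    obtain ⟨D, hD⟩ := isCompact_univ.exists_bound_of_continuousOn hf'.continuousOn
    exact Integrable.of_bound (hmeas 0) D (Filter.Eventually.of_forall fun x => hD _ (Set.mem_univ _))
  have hmeas' : AEStronglyMeasurable (fun x : Box N p =>
      pderiv (fun x => f (t, x)) k (x + Pi.single k ((0 : ℝ) : UnitAddCircle))) volume :=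
    Continuous.aestronglyMeasurable (hcont.comp (hshift _))
  have h := (hasDerivAt_integral_of_dominated_loc_of_deriv_le (bound := fun _ => C)
    Filter.univ_mem (Filter.Eventually.of_forall hmeas) hint hmeas'
    (Filter.Eventually.of_forall fun x s _ => hC _ (Set.mem_univ _))
    (integrable_const C)
    (Filter.Eventually.of_forall fun x s _ => hf.hasDerivAt_pderiv k t x s)).2
  have hconst : (fun s : ℝ => ∫ x : Box N p, f (t, x + Pi.single k (s : UnitAddCircle))) =
      fun _ => ∫ x : Box N p, f (t, x) := by
    ext s
    exact integral_add_right_eq_self (fun x => f (t, x)) _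
  rw [hconst] at h
  have := h.unique (hasDerivAt_const _ _)
  simpa using this

end SmoothLift

lemma ae_mem_Ioo_cyl (T : ℝ) : ∀ᵐ z ∂(cyl N p T), z.1 ∈ Set.Ioo 0 T := by
  unfold cyl
  exact Measure.quasiMeasurePreserving_fst.ae (ae_restrict_mem measurableSet_Ioo)

/-- A continuous function on `ℝ × Ω` is bounded on `(0,T) × Ω`. -/
lemma memLp_top_cyl_of_continuous {F : Type*} [NormedAddCommGroup F] [SecondCountableTopology F]
    (T : ℝ) {f : ℝ × Box N p → F} (hf : Continuous f) : MemLp f ⊤ (cyl N p T) := by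
  obtain ⟨C, hC⟩ := ((isCompact_Icc (a := (0 : ℝ)) (b := T)).prod
    (isCompact_univ (X := Box N p))).exists_bound_of_continuousOn hf.continuousOn
  borelize F
  refine memLp_top_of_bound hf.stronglyMeasurable.aestronglyMeasurable C ?_
  filter_upwards [ae_mem_Ioo_cyl T] with z hz
  exact hC z ⟨Set.Ioo_subset_Icc_self hz, Set.mem_univ _⟩

namespace IsTestField
variable {Ψ : ℝ × Box N p → Mat N p}

lemma smoothLift_opU (hΨ : IsTestField Ψ) (i : Fin N) : SmoothLift fun z => opU (Ψ z) i := by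
  unfold SmoothLift opU
  refine contDiff_const.mul (ContDiff.sum fun l _ => (hΨ.smooth _ _).add
    (ContDiff.sum fun j _ => (hΨ.smooth _ _).add (hΨ.smooth _ _)))

lemma continuous_timeDeriv (hΨ : IsTestField Ψ) (a c : Idx N p) :
    Continuous fun z => timeDeriv Ψ z a c :=
  SmoothLift.continuous_deriv (f := fun z => Ψ z a c) (hΨ.smooth a c)

lemma continuous_opL (hΨ : IsTestField Ψ) :
    Continuous fun z : ℝ × Box N p => opL (fun x => Ψ (z.1, x)) z.2 := by
  refine (PiLp.continuous_toLp 2 _).comp (continuous_pi fun a => ?_)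
  exact ((hΨ.smoothLift_opU a.1).continuous_pderiv a.2).neg

lemma integral_opL_apply (hΨ : IsTestField Ψ) (t : ℝ) (a : Idx N p) :
    ∫ x, opL (fun x => Ψ (t, x)) x a = 0 := by
  simp only [opL, integral_neg]
  rw [(hΨ.smoothLift_opU a.1).integral_pderiv a.2 t, neg_zero]

end IsTestField

/-! ### The range of `𝔘*` and the linear constraint -/

/-- A real square integrable function on the torus whose integrals against all trigonometric
monomials vanish is zero almost everywhere. -/
lemma ae_eq_zero_of_integral_mFourier {f : Box N p → ℝ} (hf : MemLp f 2 volume)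
    (hre : ∀ n, ∫ x, (UnitAddTorus.mFourier n x).re * f x = 0)
    (him : ∀ n, ∫ x, (UnitAddTorus.mFourier n x).im * f x = 0) : f =ᵐ[volume] 0 := by
  have hfc : MemLp (fun x => (f x : ℂ)) 2 volume := hf.ofReal
  set F := hfc.toLp
  set Λ : C(Box N p, ℂ) →L[ℂ] ℂ :=
    (innerSL ℂ F).comp (ContinuousMap.toLp 2 (volume : Measure (Box N p)) ℂ)
  have hΛ : ∀ g, Λ g = ∫ x, g x * f x := by
    intro g
    simp only [Λ, ContinuousLinearMap.comp_apply, innerSL_apply_apply, L2.inner_def]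
    refine integral_congr_ae ?_
    filter_upwards [ContinuousMap.coeFn_toLp (p := 2) (𝕜 := ℂ) volume g, hfc.coeFn_toLp]
      with x hx hx'
    simp only [F]
    rw [hx, hx']
    simp
  have hfou : ∀ n, Λ (UnitAddTorus.mFourier n) = 0 := by
    intro n
    have hint : Integrable (fun x => UnitAddTorus.mFourier n x * (f x : ℂ)) volume := by
      refine (hfc.integrable (by norm_num)).bdd_mul (c := 1)
        (UnitAddTorus.mFourier n).continuous.aestronglyMeasurable
        (Filter.Eventually.of_forall fun x => ?_)
      exact ((UnitAddTorus.mFourier n).norm_coe_le_norm x).trans UnitAddTorus.mFourier_norm.le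
    rw [hΛ]
    apply Complex.ext
    · rw [← RCLike.re_eq_complex_re, ← integral_re hint]
      simpa using hre n
    · rw [← RCLike.im_eq_complex_im, ← integral_im hint]
      simpa using him n
  have hzero : ∀ g, Λ g = 0 := by
    have h1 : Submodule.span ℂ (Set.range (UnitAddTorus.mFourier (d := Fin N × Fin p))) ≤
        LinearMap.ker Λ.toLinearMap := by
      rw [Submodule.span_le]
      rintro _ ⟨n, rfl⟩
      exact hfou n
    have h2 := Submodule.topologicalClosure_minimal _ h1 Λ.isClosed_ker
    rw [UnitAddTorus.span_mFourier_closure_eq_top] at h2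
    exact fun g => h2 trivial
  have hF : F = 0 :=
    (ContinuousMap.toLp_denseRange ℂ (volume : Measure (Box N p)) ℂ
      (ENNReal.ofNat_ne_top (n := 2))).eq_zero_of_inner_left ℂ hzero
  have h3 := hfc.coeFn_toLp
  have h4 : (hfc.toLp : Box N p → ℂ) =ᵐ[volume] 0 := by
    rw [show hfc.toLp = 0 from hF]
    exact Lp.coeFn_zero _ _ _
  filter_upwards [h3, h4] with x hx hx'
  rw [hx'] at hx
  simpa using hx.symm

lemma contDiff_mFourier_toBox (n : Fin N × Fin p → ℤ) :
    ContDiff ℝ ∞ fun y : Fin N × Fin p → ℝ => UnitAddTorus.mFourier n (toBox y) := by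
  have : (fun y : Fin N × Fin p → ℝ => UnitAddTorus.mFourier n (toBox y)) =
      fun y => ∏ k, Complex.exp (2 * Real.pi * Complex.I * n k * (y k : ℝ)) := by
    ext y
    simp only [UnitAddTorus.mFourier, ContinuousMap.coe_mk, toBox]
    refine Finset.prod_congr rfl fun k _ => ?_
    rw [fourier_coe_apply]
    simp
  rw [this]
  refine contDiff_prod fun k _ => ContDiff.cexp (contDiff_const.mul ?_)
  exact Complex.ofRealCLM.contDiff.comp (contDiff_apply ℝ ℝ k)

/-- A function in `L²((0,T) × Ω)` that is orthogonal to all products of a smooth compactly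
supported function of time and a smooth function on the torus is zero almost everywhere. -/
lemma ae_eq_zero_of_integral_prod {T : ℝ} {f : ℝ × Box N p → ℝ} (hf : MemLp f 2 (cyl N p T))
    (h : ∀ χ : ℝ → ℝ, ContDiff ℝ ∞ χ → ∀ φ : Box N p → ℝ, Continuous φ →
      ContDiff ℝ ∞ (fun y => φ (toBox y)) → ∫ z, χ z.1 * (φ z.2 * f z) ∂(cyl N p T) = 0) :
    f =ᵐ[cyl N p T] 0 := by
  have hslice : ∀ φ : Box N p → ℝ, Continuous φ → ContDiff ℝ ∞ (fun y => φ (toBox y)) →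
      ∀ᵐ t ∂(volume.restrict (Set.Ioo 0 T)), ∫ x, φ x * f (t, x) = 0 := by
    intro φ hφ hφs
    have hint : Integrable (fun z : ℝ × Box N p => φ z.2 * f z) (cyl N p T) := by
      obtain ⟨C, hC⟩ := isCompact_univ.exists_bound_of_continuousOn hφ.continuousOn
      exact (hf.integrable (by norm_num)).bdd_mul (c := C)
        (hφ.comp continuous_snd).aestronglyMeasurable
        (Filter.Eventually.of_forall fun z => hC _ (Set.mem_univ _))
    have hint' := Integrable.integral_prod_left hint
    refine ae_eq_zero_of_integral_contDiff_smul_eq_zero hint'.locallyIntegrable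
      fun χ hχ hχc => ?_
    obtain ⟨C, hC⟩ := hχc.exists_bound_of_continuous hχ.continuous
    have h1 : Integrable (fun z : ℝ × Box N p => χ z.1 * (φ z.2 * f z)) (cyl N p T) :=
      hint.bdd_mul (c := C) (hχ.continuous.comp continuous_fst).aestronglyMeasurable
        (Filter.Eventually.of_forall fun z => hC _)
    refine Eq.trans ?_ (h χ hχ φ hφ hφs)
    unfold cyl at h1 ⊢
    rw [integral_prod _ h1]
    simp [integral_const_mul]
  have hL2 : ∀ᵐ t ∂(volume.restrict (Set.Ioo 0 T)), MemLp (fun x => f (t, x)) 2 volume := by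
    have h1 := hf.integrable_sq
    have h2 := hf.aestronglyMeasurable
    unfold cyl at h1 h2
    filter_upwards [h1.prod_right_ae, h2.prodMk_left] with t ht ht'
    exact (memLp_two_iff_integrable_sq ht').2 ht
  have hre : ∀ᵐ t ∂(volume.restrict (Set.Ioo 0 T)), ∀ n : Fin N × Fin p → ℤ,
      ∫ x, (UnitAddTorus.mFourier n x).re * f (t, x) = 0 :=
    ae_all_iff.2 fun n => hslice _ (Complex.continuous_re.comp (map_continuous _))
      (Complex.reCLM.contDiff.comp (contDiff_mFourier_toBox n))
  have him : ∀ᵐ t ∂(volume.restrict (Set.Ioo 0 T)), ∀ n : Fin N × Fin p → ℤ,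
      ∫ x, (UnitAddTorus.mFourier n x).im * f (t, x) = 0 :=
    ae_all_iff.2 fun n => hslice _ (Complex.continuous_im.comp (map_continuous _))
      (Complex.imCLM.contDiff.comp (contDiff_mFourier_toBox n))
  have hae : ∀ᵐ t ∂(volume.restrict (Set.Ioo 0 T)), ∀ᵐ x ∂(volume : Measure (Box N p)),
      f (t, x) = 0 := by
    filter_upwards [hL2, hre, him] with t h1 h2 h3
    exact ae_eq_zero_of_integral_mFourier h1 h2 h3
  have hsq : ∫ z, f z ^ 2 ∂(cyl N p T) = 0 := by
    have h1 := hf.integrable_sq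
    unfold cyl at h1 ⊢
    rw [integral_prod _ h1]
    refine integral_eq_zero_of_ae ?_
    filter_upwards [hae] with t ht
    refine integral_eq_zero_of_ae ?_
    filter_upwards [ht] with x hx
    simp [hx]
  rw [integral_eq_zero_iff_of_nonneg (fun _ => sq_nonneg _) hf.integrable_sq] at hsq
  filter_upwards [hsq] with z hz
  simpa using hz

lemma hasDerivAt_primitive {χ : ℝ → ℝ} (hχ : Continuous χ) (t : ℝ) :
    HasDerivAt (fun t => ∫ s in (0 : ℝ)..t, χ s) (χ t) t :=
  intervalIntegral.integral_hasDerivAt_right (hχ.intervalIntegrable _ _)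
    (hχ.stronglyMeasurableAtFilter _ _) hχ.continuousAt

lemma contDiff_primitive {χ : ℝ → ℝ} (hχ : ContDiff ℝ ∞ χ) :
    ContDiff ℝ ∞ fun t => ∫ s in (0 : ℝ)..t, χ s := by
  have hd := hasDerivAt_primitive hχ.continuous
  rw [contDiff_infty_iff_deriv]
  refine ⟨fun t => (hd t).differentiableAt, ?_⟩
  rwa [show deriv (fun t => ∫ s in (0 : ℝ)..t, χ s) = χ from funext fun t => (hd t).deriv]

/-- The constraint, tested with fields in the kernel of `𝔘`, says that `B` is orthogonal to this
kernel. -/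
lemma LinConstraint.frob_ae_eq_zero {T : ℝ} {E : ℝ × Box N p → Vec N p}
    {B : ℝ × Box N p → Mat N p} (hB : ∀ a b, MemLp (fun z => B z a b) ⊤ (cyl N p T))
    (h : LinConstraint T E B) {K : Mat N p} (hK : K.IsSymm) (hUK : ∀ i, opU K i = 0) :
    ∀ᵐ z ∂(cyl N p T), frob (B z) K = 0 := by
  have hL2 : MemLp (fun z => frob (B z) K) 2 (cyl N p T) := by
    unfold frob
    refine memLp_finsetSum _ fun a _ => memLp_finsetSum _ fun b _ => ?_
    have := ((hB a b).mono_exponent (p := 2) le_top).const_mul (K a b)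
    exact this.congr_norm (by
      simpa only [mul_comm] using this.aestronglyMeasurable) (by simp [mul_comm])
  refine ae_eq_zero_of_integral_prod hL2 fun χ hχ φ hφ hφs => ?_
  -- The primitive of `χ` is used so that the field vanishes at `t = 0`.
  set X : ℝ → ℝ := fun t => ∫ s in (0 : ℝ)..t, χ s
  have hX : ContDiff ℝ ∞ X := contDiff_primitive hχ
  have hX' : ∀ t, HasDerivAt X (χ t) t := hasDerivAt_primitive hχ.continuous
  set Ψ : ℝ × Box N p → Mat N p := fun z => (X z.1 * φ z.2) • K
  have hΨ : IsTestField Ψ := by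
    refine ⟨fun a b => ?_, fun z => hK.smul _, fun x => ?_⟩
    · exact ((hX.comp contDiff_fst).mul (hφs.comp contDiff_snd)).mul contDiff_const
    · simp [Ψ, X]
  have hL : ∀ z : ℝ × Box N p, opL (fun x => Ψ (z.1, x)) z.2 = 0 := by
    intro z
    ext a
    simp [opL, Ψ, opU_smul, hUK, pderiv]
  have hD : ∀ z, timeDeriv Ψ z = (χ z.1 * φ z.2) • K := by
    intro z
    ext a b
    simp only [timeDeriv, Ψ, Matrix.of_apply, Matrix.smul_apply, smul_eq_mul]
    exact (((hX' z.1).mul_const _).mul_const _).deriv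
  have := h Ψ hΨ
  simp only [hL, hD, inner_zero_right, add_zero, frob_smul_right, mul_assoc] at this
  exact this

/-- A bounded solution `B` of the linear constraint lies in the range of `𝔘*`. -/
lemma LinConstraint.ae_eq_opUadj {T : ℝ} {E : ℝ × Box N p → Vec N p}
    {B : ℝ × Box N p → Mat N p} (hEB : InDualClass T E B) (h : LinConstraint T E B) (l : Fin p) :
    ∀ᵐ z ∂(cyl N p T), B z = opUadj fun i => 2 * B z (i, i, l) (i, i, l) := by
  have h1 : ∀ᵐ z ∂(cyl N p T), ∀ a c,
      frob (B z) (symUnit a c - ∑ i, opU (symUnit a c) i • dualUnit l i) = 0 := by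
    rw [ae_all_iff]; intro a
    rw [ae_all_iff]; intro c
    refine h.frob_ae_eq_zero hEB.memLp_B ?_ (opU_orthogonal_eq_zero l _)
    have hs : ∀ (s : Finset (Fin N)) (f : Fin N → ℝ),
        (∑ i ∈ s, f i • dualUnit l i : Mat N p).IsSymm := by
      intro s f
      rw [Matrix.IsSymm, Matrix.transpose_sum]
      exact Finset.sum_congr rfl fun i _ => (isSymm_dualUnit l i).smul _
    exact (isSymm_symUnit a c).sub (hs _ _)
  filter_upwards [h1, hEB.symm_B] with z hz hs
  exact eq_opUadj_of_orthogonal hs l hz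

/-! ### The Lagrangian -/

lemma integrable_frob_of_left {α : Type*} [MeasurableSpace α] {μ : Measure α} {M S : α → Mat N p}
    (hM : ∀ a b, MemLp (fun z => M z a b) 1 μ) (hS : ∀ a b, MemLp (fun z => S z a b) ⊤ μ) :
    Integrable (fun z => frob (M z) (S z)) μ := by
  unfold frob
  exact integrable_finsetSum _ fun a _ => integrable_finsetSum _ fun b _ =>
    (memLp_one_iff_integrable.1 (hM a b)).mul_of_top_left (hS a b)

lemma integrable_frob_of_right {α : Type*} [MeasurableSpace α] {μ : Measure α} {M S : α → Mat N p}
    (hM : ∀ a b, MemLp (fun z => M z a b) ⊤ μ) (hS : ∀ a b, MemLp (fun z => S z a b) 1 μ) :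
    Integrable (fun z => frob (M z) (S z)) μ :=
  (integrable_frob_of_left hS hM).congr (Filter.Eventually.of_forall fun _ => frob_comm _ _)

lemma integrable_inner_of_memLp {α F : Type*} [NormedAddCommGroup F] [InnerProductSpace ℝ F]
    [MeasurableSpace α] {μ : Measure α} {f g : α → F} (hf : MemLp f 2 μ) (hg : MemLp g 2 μ) :
    Integrable (fun z => inner ℝ (f z) (g z)) μ :=
  (L2.integrable_inner (𝕜 := ℝ) hf.toLp hg.toLp).congr (by
    filter_upwards [hf.coeFn_toLp, hg.coeFn_toLp] with z h1 h2
    rw [h1, h2])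

lemma memLp_tensorSq_one {α : Type*} [MeasurableSpace α] {μ : Measure α} {v : α → Vec N p}
    (hv : MemLp v 2 μ) (a b : Idx N p) : MemLp (fun z => tensorSq (v z) a b) 1 μ :=
  memLp_one_iff_integrable.2 (MemLp.integrable_mul (hv.eval_piLp a) (hv.eval_piLp b))

lemma memLp_tensorSq_top {α : Type*} [MeasurableSpace α] {μ : Measure α} {v : α → Vec N p}
    (hv : MemLp v ⊤ μ) (a b : Idx N p) : MemLp (fun z => tensorSq (v z) a b) ⊤ μ :=
  MemLp.mul' (hv.eval_piLp b) (hv.eval_piLp a)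

lemma memLp_opU {α : Type*} [MeasurableSpace α] {μ : Measure α} {q : ENNReal} {A : α → Mat N p}
    (hA : ∀ a b, MemLp (fun z => A z a b) q μ) (i : Fin N) :
    MemLp (fun z => opU (A z) i) q μ := by
  simp only [opU_eq_sum (A _)]
  exact memLp_finsetSum _ fun a _ => memLp_finsetSum _ fun c _ =>
    (hA a c).mul_const (opU (symUnit a c) i)

lemma memLp_opUadj {α : Type*} [MeasurableSpace α] {μ : Measure α} {q : ENNReal}
    {b : α → Fin N → ℝ} (hb : ∀ i, MemLp (fun z => b z i) q μ) (a c : Idx N p) :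
    MemLp (fun z => (opUadj (b z) : Mat N p) a c) q μ := by
  simp only [opUadj, Matrix.of_apply]
  exact memLp_finsetSum _ fun i _ => (hb i).mul_const (opU (symUnit a c) i)

lemma memLp_perturbed {q : ENNReal} {B : ℝ × Box N p → Mat N p}
    (hB : ∀ a b, MemLp (fun z => B z a b) q (cyl N p T)) (a b : Idx N p) :
    MemLp (fun z => (1 + (2 : ℝ) • B z) a b) q (cyl N p T) := by
  simp only [Matrix.add_apply, Matrix.smul_apply, smul_eq_mul]
  exact MemLp.add (f := fun _ => (1 : Mat N p) a b) (g := fun z => 2 * B z a b) (memLp_const _)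
    ((hB a b).const_mul 2)

lemma memLp_comp_snd {v0 : Box N p → Vec N p} (hv0 : MemLp v0 2 volume) :
    MemLp (fun z : ℝ × Box N p => v0 z.2) 2 (cyl N p T) := by
  unfold cyl
  exact MemLp.comp_snd hv0 (volume.restrict (Set.Ioo 0 T))

/-- The part of the integrand of the dual functional that depends on the multiplier `v`. -/
def quadIntegrand (vbar E : ℝ × Box N p → Vec N p) (B : ℝ × Box N p → Mat N p)
    (v : ℝ × Box N p → Vec N p) (z : ℝ × Box N p) : ℝ :=
  inner ℝ (v z) (E z - vbar z) + (1 / 2) * frob (tensorSq (v z)) (1 + (2 : ℝ) • B z)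

/-- The part of the integrand of the dual functional that does not depend on `v`. -/
def baseIntegrand (v0 : Box N p → Vec N p) (vbar E : ℝ × Box N p → Vec N p)
    (z : ℝ × Box N p) : ℝ :=
  - inner ℝ (v0 z.2) (E z) + (1 / 2) * inner ℝ (vbar z) (vbar z)

/-- The Lagrangian `∫₀ᵀ [-(v₀, E) + ½ (v̄, v̄) + (v, E - v̄) + ½ (v ⊗ v, I + 2B)] dt`. Its infimum
over `v` is the functional maximized in both forms of the dual problem. -/
def lagrangian (T : ℝ) (v0 : Box N p → Vec N p) (vbar E : ℝ × Box N p → Vec N p)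
    (B : ℝ × Box N p → Mat N p) (v : ℝ × Box N p → Vec N p) : ℝ :=
  ∫ z, (baseIntegrand v0 vbar E z + quadIntegrand vbar E B v z) ∂(cyl N p T)

section
variable {v0 : Box N p → Vec N p} {vbar E v : ℝ × Box N p → Vec N p} {B : ℝ × Box N p → Mat N p}

lemma integrable_baseIntegrand (hv0 : MemLp v0 2 volume) (hvbar : MemLp vbar 2 (cyl N p T))
    (hE : MemLp E 2 (cyl N p T)) : Integrable (baseIntegrand v0 vbar E) (cyl N p T) :=
  (integrable_inner_of_memLp (memLp_comp_snd hv0) hE).neg.add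
    ((integrable_inner_of_memLp hvbar hvbar).const_mul _)

lemma integrable_quadIntegrand (hvbar : MemLp vbar 2 (cyl N p T))
    (hE : MemLp E 2 (cyl N p T)) (hB : ∀ a b, MemLp (fun z => B z a b) ⊤ (cyl N p T))
    (hv : MemLp v 2 (cyl N p T)) : Integrable (quadIntegrand vbar E B v) (cyl N p T) :=
  (integrable_inner_of_memLp hv (hE.sub hvbar)).add
    ((integrable_frob_of_left (memLp_tensorSq_one hv) (memLp_perturbed hB)).const_mul _)

lemma integrable_quadIntegrand_of_top (hvbar : MemLp vbar 2 (cyl N p T))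
    (hE : MemLp E 2 (cyl N p T)) (hB : ∀ a b, MemLp (fun z => B z a b) 1 (cyl N p T))
    (hv : MemLp v ⊤ (cyl N p T)) : Integrable (quadIntegrand vbar E B v) (cyl N p T) :=
  (integrable_inner_of_memLp (hv.mono_exponent le_top) (hE.sub hvbar)).add
    ((integrable_frob_of_right (memLp_tensorSq_top hv) (memLp_perturbed hB)).const_mul _)

/-- A real number bounds the dual term of `(E, B)` from below iff it bounds the Lagrangian. -/
lemma le_dualTerm_iff (hv0 : MemLp v0 2 volume) (hvbar : MemLp vbar 2 (cyl N p T))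
    (hEB : InDualClass T E B) (c : ℝ) :
    (c : EReal) ≤ (⨅ (v : ℝ × Box N p → Vec N p) (_ : MemLp v 2 (cyl N p T)),
      ((∫ z, (inner ℝ (v z - v0 z.2) (E z - vbar z) +
        (1 / 2) * frob (tensorSq (v z)) (1 + (2 : ℝ) • B z)) ∂(cyl N p T) : ℝ) : EReal)) +
      (functionalC T vbar v0 : EReal) ↔
    ∀ v, MemLp v 2 (cyl N p T) → c ≤ lagrangian T v0 vbar E B v := by
  rw [← EReal.sub_le_iff_le_add (Or.inl (EReal.coe_ne_bot _)) (Or.inl (EReal.coe_ne_top _)),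
    ← EReal.coe_sub]
  simp only [le_iInf_iff, EReal.coe_le_coe_iff]
  refine forall₂_congr fun v hv => ?_
  have h1 : Integrable (fun z => inner ℝ (v z - v0 z.2) (E z - vbar z) +
        (1 / 2) * frob (tensorSq (v z)) (1 + (2 : ℝ) • B z)) (cyl N p T) :=
    (integrable_inner_of_memLp (hv.sub (memLp_comp_snd hv0)) (hEB.memLp_E.sub hvbar)).add
      ((integrable_frob_of_left (memLp_tensorSq_one hv) (memLp_perturbed hEB.memLp_B)).const_mul _)
  have h2 : lagrangian T v0 vbar E B v = (∫ z, (inner ℝ (v z - v0 z.2) (E z - vbar z) +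
      (1 / 2) * frob (tensorSq (v z)) (1 + (2 : ℝ) • B z)) ∂(cyl N p T)) +
      functionalC T vbar v0 := by
    refine Eq.trans ?_ (integral_add h1 (integrable_baseIntegrand hv0 hvbar hvbar))
    refine integral_congr_ae (Filter.Eventually.of_forall fun z => ?_)
    simp only [baseIntegrand, quadIntegrand, inner_sub_left, inner_sub_right]
    ring
  rw [h2, sub_le_iff_le_add]

/-- For an admissible pair, `M = z ⊗ z` is optimal in the definition of `𝓚`, so that the objective
of the concave dual problem is the infimum of the Lagrangian. -/
lemma le_concaveObjective_iff (hv0 : MemLp v0 2 volume) (hvbar : MemLp vbar 2 (cyl N p T))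
    (hEB : IsAdmissible T E B) (c : ℝ) :
    (c : EReal) ≤ concaveObjective T v0 vbar E B ↔
    ∀ v, MemLp v 2 (cyl N p T) → c ≤ lagrangian T v0 vbar E B v := by
  have hbase := integrable_baseIntegrand hv0 hvbar hEB.inClass.memLp_E
  rw [concaveObjective, add_comm,
    ← EReal.sub_le_iff_le_add (Or.inl (EReal.coe_ne_bot _)) (Or.inl (EReal.coe_ne_top _)),
    ← EReal.coe_sub, functionalK]
  simp only [le_iInf_iff, EReal.coe_le_coe_iff]
  have hlag : ∀ v, MemLp v 2 (cyl N p T) → lagrangian T v0 vbar E B v =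
      (∫ z, quadIntegrand vbar E B v z ∂(cyl N p T)) + ∫ z, baseIntegrand v0 vbar E z ∂(cyl N p T) :=
    fun v hv => by
      rw [lagrangian, integral_add hbase
        (integrable_quadIntegrand hvbar hEB.inClass.memLp_E hEB.inClass.memLp_B hv), add_comm]
  constructor
  · intro h v hv
    have hpair : IsMomentPair T v fun z => tensorSq (v z) :=
      ⟨hv, memLp_tensorSq_one hv, Filter.Eventually.of_forall fun z => by
        ext a b; simp [tensorSq, mul_comm], Filter.Eventually.of_forall fun z => by
        simpa using Matrix.PosSemidef.zero⟩
    rw [hlag v hv]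
    exact sub_le_iff_le_add.1 (h v _ hpair)
  · intro h z M hM
    have h1 := h z hM.memLp_z
    rw [hlag z hM.memLp_z] at h1
    refine (sub_le_iff_le_add.2 h1).trans ?_
    refine integral_mono_ae
      (integrable_quadIntegrand hvbar hEB.inClass.memLp_E hEB.inClass.memLp_B hM.memLp_z)
      ((integrable_inner_of_memLp hM.memLp_z (hEB.inClass.memLp_E.sub hvbar)).add
        ((integrable_frob_of_left hM.memLp_M
          (memLp_perturbed hEB.inClass.memLp_B)).const_mul _)) ?_
    filter_upwards [hM.le, hEB.nonneg] with w hw hw'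
    have h2 := frob_nonneg_of_posSemidef hw hw'
    rw [frob_sub_left] at h2
    simp only [quadIntegrand]
    linarith

lemma quadIntegrand_indicator (A : Set (ℝ × Box N p)) :
    quadIntegrand vbar E B (A.indicator v) = A.indicator (quadIntegrand vbar E B v) := by
  ext z
  by_cases hz : z ∈ A <;> simp [quadIntegrand, hz, frob, tensorSq]

/-- If the Lagrangian is bounded from below on bounded `v`, then `I + 2B` is nonnegative: test with
`v = r u 1_A` for a constant vector `u` and let `r → ∞`. -/
lemma ae_nonneg_of_le_lagrangian (hv0 : MemLp v0 2 volume) (hvbar : MemLp vbar 2 (cyl N p T))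
    (hE : MemLp E 2 (cyl N p T)) (hB : ∀ a b, MemLp (fun z => B z a b) 1 (cyl N p T)) {c : ℝ}
    (h : ∀ v, MemLp v ⊤ (cyl N p T) → c ≤ lagrangian T v0 vbar E B v) :
    ∀ᵐ z ∂(cyl N p T), ∀ u : Vec N p, 0 ≤ frob (tensorSq u) (1 + (2 : ℝ) • B z) := by
  have hfix : ∀ u : Vec N p, ∀ᵐ z ∂(cyl N p T), 0 ≤ frob (tensorSq u) (1 + (2 : ℝ) • B z) := by
    intro u
    have hf : Integrable (fun z => frob (tensorSq u) (1 + (2 : ℝ) • B z)) (cyl N p T) :=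
      integrable_frob_of_right (M := fun _ => tensorSq u)
        (memLp_tensorSq_top (memLp_const u)) (memLp_perturbed hB)
    refine ae_nonneg_of_forall_setIntegral_nonneg hf fun A hA _ => ?_
    have hi : Integrable (fun z => inner ℝ u (E z - vbar z)) (cyl N p T) :=
      integrable_inner_of_memLp (memLp_const u) (hE.sub hvbar)
    set κ := ∫ z, baseIntegrand v0 vbar E z ∂(cyl N p T)
    set a := ∫ z in A, inner ℝ u (E z - vbar z) ∂(cyl N p T)
    set d := ∫ z in A, frob (tensorSq u) (1 + (2 : ℝ) • B z) ∂(cyl N p T)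
    have key : ∀ r : ℝ, c ≤ κ + r * a + r ^ 2 / 2 * d := by
      intro r
      have hconst : MemLp (fun _ : ℝ × Box N p => r • u) ⊤ (cyl N p T) := memLp_const _
      have h1 := h (A.indicator fun _ => r • u) (hconst.indicator hA)
      rw [lagrangian, integral_add (integrable_baseIntegrand hv0 hvbar hE)
        (integrable_quadIntegrand_of_top hvbar hE hB (hconst.indicator hA)),
        quadIntegrand_indicator, integral_indicator hA] at h1
      have h2 : quadIntegrand vbar E B (fun _ => r • u) = fun z =>
          r * inner ℝ u (E z - vbar z) + r ^ 2 / 2 * frob (tensorSq u) (1 + (2 : ℝ) • B z) := by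
        ext z
        have : tensorSq (r • u) = r ^ 2 • tensorSq u := by
          ext i j; simp [tensorSq]; ring
        rw [quadIntegrand, this, frob_comm, frob_smul_right, frob_comm, inner_smul_left]
        simp; ring
      rw [h2, integral_add (hi.integrableOn.const_mul _) (hf.integrableOn.const_mul _),
        integral_const_mul, integral_const_mul] at h1
      linarith
    by_contra hd
    push Not at hd
    have h0 := key 0
    have hs : 0 ≤ 2 * (κ - c + 1) / (-d) := by
      apply div_nonneg <;> linarith
    -- Averaging over `± r` removes the linear term, and this `r` makes the quadratic one equal to
    -- `-(κ - c + 1)`.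
    have h1 := key (Real.sqrt (2 * (κ - c + 1) / (-d)))
    have h2 := key (-Real.sqrt (2 * (κ - c + 1) / (-d)))
    rw [neg_sq] at h2
    rw [Real.sq_sqrt hs] at h1 h2
    have h3 : 2 * (κ - c + 1) / (-d) / 2 * d = -(κ - c + 1) := by
      field_simp [hd.ne]
    rw [h3] at h1 h2
    linarith
  have hdense : ∀ᵐ z ∂(cyl N p T), ∀ n,
      0 ≤ frob (tensorSq (TopologicalSpace.denseSeq (Vec N p) n)) (1 + (2 : ℝ) • B z) :=
    ae_all_iff.2 fun n => hfix _
  filter_upwards [hdense] with z hz u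
  have hcont : Continuous fun u : Vec N p => frob (tensorSq u) (1 + (2 : ℝ) • B z) := by
    simp only [frob, tensorSq, Matrix.of_apply]
    fun_prop
  exact (TopologicalSpace.denseRange_denseSeq (Vec N p)).induction_on u
    (isClosed_le continuous_const hcont) hz

open Filter Topology in
/-- A lower bound for the Lagrangian on bounded `v` extends to square integrable `v`, by
truncation. -/
lemma le_lagrangian_of_top (hv0 : MemLp v0 2 volume) (hvbar : MemLp vbar 2 (cyl N p T))
    (hE : MemLp E 2 (cyl N p T)) (hB : ∀ a b, MemLp (fun z => B z a b) ⊤ (cyl N p T)) {c : ℝ}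
    (h : ∀ v, MemLp v ⊤ (cyl N p T) → c ≤ lagrangian T v0 vbar E B v)
    (hv : MemLp v 2 (cyl N p T)) : c ≤ lagrangian T v0 vbar E B v := by
  set A : ℕ → Set (ℝ × Box N p) := fun n => {z | ‖v z‖ ≤ n}
  have hA : ∀ n, NullMeasurableSet (A n) (cyl N p T) := fun n =>
    nullMeasurableSet_le hv.1.norm.aemeasurable aemeasurable_const
  have hbase := integrable_baseIntegrand hv0 hvbar hE
  have hquad := integrable_quadIntegrand hvbar hE hB hv
  have hlim : Tendsto (fun n => lagrangian T v0 vbar E B ((A n).indicator v)) atTop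
      (𝓝 (lagrangian T v0 vbar E B v)) := by
    unfold lagrangian
    simp only [quadIntegrand_indicator]
    refine tendsto_integral_of_dominated_convergence
      (fun z => ‖baseIntegrand v0 vbar E z‖ + ‖quadIntegrand vbar E B v z‖)
      (fun n => hbase.1.add (hquad.1.indicator₀ (hA n))) (hbase.norm.add hquad.norm)
      (fun n => Eventually.of_forall fun z => ?_) (Eventually.of_forall fun z => ?_)
    · exact (norm_add_le _ _).trans (add_le_add le_rfl (norm_indicator_le_norm_self _ _))
    · refine tendsto_const_nhds.add ?_
      obtain ⟨m, hm⟩ := exists_nat_ge ‖v z‖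
      refine tendsto_const_nhds.congr' (eventually_atTop.2 ⟨m, fun n hn => ?_⟩)
      have hz : z ∈ A n := hm.trans (by exact_mod_cast hn)
      exact (Set.indicator_of_mem hz _).symm
  refine ge_of_tendsto' hlim fun n => h _ ?_
  refine memLp_top_of_bound (hv.1.indicator₀ (hA n)) n (Eventually.of_forall fun z => ?_)
  by_cases hz : z ∈ A n
  · rw [Set.indicator_of_mem hz]; exact hz
  · rw [Set.indicator_of_notMem hz]; simp

end

/-! ### Coercivity and the Hilbert space of states -/

lemma lagrangian_congr {v0 : Box N p → Vec N p} {vbar E v : ℝ × Box N p → Vec N p}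
    {B B' : ℝ × Box N p → Mat N p} (h : ∀ᵐ z ∂(cyl N p T), B z = B' z) :
    lagrangian T v0 vbar E B v = lagrangian T v0 vbar E B' v := by
  refine integral_congr_ae ?_
  filter_upwards [h] with z hz
  simp only [quadIntegrand, hz]

lemma frob_perturbed_opUadj_le {b : Fin N → ℝ} (hb : ∀ i, |b i| ≤ 3) (v : Vec N p) :
    frob (tensorSq v) (1 + (2 : ℝ) • opUadj b) ≤ (1 + 6 * N * (p * (N + 1))) * ‖v‖ ^ 2 := by
  rw [frob_tensorSq_perturbed, frob_opUadj]
  have h1 : ∑ i, b i * opU (tensorSq v) i ≤ ∑ _i : Fin N, 3 * (p * (N + 1) * ‖v‖ ^ 2) :=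
    Finset.sum_le_sum fun i _ => (le_abs_self _).trans (by
      rw [abs_mul]
      exact mul_le_mul (hb i) (abs_opU_tensorSq_le v i) (abs_nonneg _) (by norm_num))
  simp only [Finset.sum_const, Finset.card_univ, Fintype.card_fin, nsmul_eq_mul] at h1
  linarith

/-- Pairs `(E, b)` that satisfy the constraint and for which the Lagrangian is bounded from below
give an admissible pair `(E, 𝔘* b)`. -/
lemma isAdmissible_of_le_lagrangian (hN : 1 < N) (hp : 1 ≤ p) {v0 : Box N p → Vec N p}
    {vbar E : ℝ × Box N p → Vec N p} {b : ℝ × Box N p → Fin N → ℝ}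
    (hv0 : MemLp v0 2 volume) (hvbar : MemLp vbar 2 (cyl N p T)) (hE : MemLp E 2 (cyl N p T))
    (hb : ∀ i, MemLp (fun z => b z i) 2 (cyl N p T))
    (hlin : LinConstraint T E fun z => opUadj (b z)) {c : ℝ}
    (h : ∀ v, MemLp v ⊤ (cyl N p T) → c ≤ lagrangian T v0 vbar E (fun z => opUadj (b z)) v) :
    (∀ᵐ z ∂(cyl N p T), ∀ i, |b z i| ≤ 3) ∧ IsAdmissible T E (fun z => opUadj (b z)) ∧
      ∀ v, MemLp v 2 (cyl N p T) → c ≤ lagrangian T v0 vbar E (fun z => opUadj (b z)) v := by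
  have hpos := ae_nonneg_of_le_lagrangian hv0 hvbar hE
    (memLp_opUadj fun i => (hb i).mono_exponent (by norm_num)) h
  have hb3 : ∀ᵐ z ∂(cyl N p T), ∀ i, |b z i| ≤ 3 := by
    filter_upwards [hpos] with z hz
    exact abs_le_of_posSemidef hN ⟨0, hp⟩ hz
  have hB : ∀ a c, MemLp (fun z => (opUadj (b z) : Mat N p) a c) ⊤ (cyl N p T) :=
    memLp_opUadj fun i => memLp_top_of_bound (hb i).1 3 (by
      filter_upwards [hb3] with z hz using hz i)
  refine ⟨hb3, ⟨⟨hE, hB, Filter.Eventually.of_forall fun z => isSymm_opUadj _⟩, hlin, ?_⟩,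
    fun v hv => le_lagrangian_of_top hv0 hvbar hE hB h hv⟩
  filter_upwards [hpos] with z hz
  exact (posSemidef_iff_frob (Matrix.isSymm_one.add ((isSymm_opUadj _).smul _))).2 hz

/-- Testing the Lagrangian with a small negative multiple of `E - v̄` controls `E` in `L²`. -/
lemma coercivity {v0 : Box N p → Vec N p}
    {vbar E : ℝ × Box N p → Vec N p} {b : ℝ × Box N p → Fin N → ℝ}
    (hv0 : MemLp v0 2 volume) (hvbar : MemLp vbar 2 (cyl N p T)) (hE : MemLp E 2 (cyl N p T))
    (hb : ∀ i, MemLp (fun z => b z i) ⊤ (cyl N p T))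
    (hb3 : ∀ᵐ z ∂(cyl N p T), ∀ i, |b z i| ≤ 3) {c : ℝ}
    (h : ∀ v, MemLp v 2 (cyl N p T) → c ≤ lagrangian T v0 vbar E (fun z => opUadj (b z)) v)
    {Λ : ℝ} (hΛ : Λ = 1 + 6 * N * (p * (N + 1))) :
    (∫ z, ‖E z‖ ^ 2 ∂(cyl N p T)) + 8 * Λ * c ≤
      8 * Λ * ∫ z, (2 * Λ * ‖v0 z.2‖ ^ 2 + ‖vbar z‖ ^ 2) ∂(cyl N p T) := by
  have hΛ1 : 1 ≤ Λ := by rw [hΛ]; linarith [show (0 : ℝ) ≤ 6 * N * (p * (N + 1)) by positivity]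
  have hΛ0 : 0 < Λ := by linarith
  have hsq : ∀ {f : ℝ × Box N p → Vec N p}, MemLp f 2 (cyl N p T) →
      Integrable (fun z => ‖f z‖ ^ 2) (cyl N p T) :=
    fun hf => (memLp_two_iff_integrable_sq_norm hf.1).1 hf
  have hv : MemLp (fun z => (-Λ⁻¹) • (E z - vbar z)) 2 (cyl N p T) :=
    (hE.sub hvbar).const_smul (-Λ⁻¹)
  have h1 := h _ hv
  have hi1 : Integrable (fun z => 2 * Λ * ‖v0 z.2‖ ^ 2 + ‖vbar z‖ ^ 2) (cyl N p T) :=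
    ((hsq (memLp_comp_snd hv0)).const_mul _).add (hsq hvbar)
  have hi2 : Integrable (fun z => (8 * Λ)⁻¹ * ‖E z‖ ^ 2) (cyl N p T) := (hsq hE).const_mul _
  have h2 : lagrangian T v0 vbar E (fun z => opUadj (b z)) (fun z => (-Λ⁻¹) • (E z - vbar z)) ≤
      ∫ z, ((2 * Λ * ‖v0 z.2‖ ^ 2 + ‖vbar z‖ ^ 2) - (8 * Λ)⁻¹ * ‖E z‖ ^ 2) ∂(cyl N p T) := by
    refine integral_mono_ae ((integrable_baseIntegrand hv0 hvbar hE).add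
      (integrable_quadIntegrand hvbar hE (memLp_opUadj hb) hv)) (hi1.sub hi2) ?_
    filter_upwards [hb3] with z hz
    have h3 := frob_perturbed_opUadj_le hz ((-Λ⁻¹) • (E z - vbar z))
    rw [← hΛ, norm_smul, mul_pow, norm_neg, Real.norm_of_nonneg (inv_nonneg.2 hΛ0.le)] at h3
    have h4 : Λ * (Λ⁻¹ ^ 2 * ‖E z - vbar z‖ ^ 2) = Λ⁻¹ * ‖E z - vbar z‖ ^ 2 := by
      field_simp
    rw [h4] at h3
    -- What follows turns `-‖E - v̄‖² / (2Λ)` into `-‖E‖² / (8Λ)`, half of `-‖E‖² / (4Λ)` being spent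
    -- on the term `(v₀, E)`.
    have h5 : ‖E z‖ ^ 2 ≤ 2 * ‖E z - vbar z‖ ^ 2 + 2 * ‖vbar z‖ ^ 2 := by
      have := norm_add_le (E z - vbar z) (vbar z)
      rw [sub_add_cancel] at this
      nlinarith [sq_nonneg (‖E z - vbar z‖ - ‖vbar z‖), norm_nonneg (E z)]
    have h6 : -inner ℝ (v0 z.2) (E z) ≤ 2 * Λ * ‖v0 z.2‖ ^ 2 + (8 * Λ)⁻¹ * ‖E z‖ ^ 2 := by
      have h7 := (abs_le.1 (abs_real_inner_le_norm (v0 z.2) (E z))).1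
      have h8 : 2 * Λ * ‖v0 z.2‖ ^ 2 + (8 * Λ)⁻¹ * ‖E z‖ ^ 2 - ‖v0 z.2‖ * ‖E z‖ =
          (8 * Λ)⁻¹ * (4 * Λ * ‖v0 z.2‖ - ‖E z‖) ^ 2 := by
        field_simp; ring
      have h9 : 0 ≤ (8 * Λ)⁻¹ * (4 * Λ * ‖v0 z.2‖ - ‖E z‖) ^ 2 := by positivity
      linarith
    simp only [baseIntegrand, quadIntegrand, inner_smul_left, real_inner_self_eq_norm_sq,
      conj_trivial]
    have h10 : (8 * Λ)⁻¹ = Λ⁻¹ / 8 := by rw [mul_inv]; ring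
    have h11 : Λ⁻¹ ≤ 1 := inv_le_one_of_one_le₀ hΛ1
    have h12 := mul_le_mul_of_nonneg_left h5 (inv_nonneg.2 hΛ0.le)
    have h13 := mul_le_mul_of_nonneg_right h11 (sq_nonneg ‖vbar z‖)
    rw [h10] at h6 ⊢
    linarith
  rw [integral_sub hi1 hi2, integral_const_mul] at h2
  have h3 := mul_le_mul_of_nonneg_left (h1.trans h2) (by positivity : 0 ≤ 8 * Λ)
  rw [mul_sub, ← mul_assoc (8 * Λ) (8 * Λ)⁻¹, mul_inv_cancel₀ (by positivity), one_mul] at h3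
  linarith

/-- The Hilbert space `L²((0,T) × Ω; ℝ^n) × L²((0,T) × Ω; ℝ^N)` of the unknowns `(E, b)`; the matrix
field of the dual problem is `B = 𝔘* b`. -/
abbrev StateSpace (N p : ℕ) (T : ℝ) : Type :=
  WithLp 2 (Lp (Vec N p) 2 (cyl N p T) × Lp (EuclideanSpace ℝ (Fin N)) 2 (cyl N p T))

/-- The element of the state space given by two square integrable functions. -/
def mkState {f : ℝ × Box N p → Vec N p} {g : ℝ × Box N p → EuclideanSpace ℝ (Fin N)}
    (hf : MemLp f 2 (cyl N p T)) (hg : MemLp g 2 (cyl N p T)) : StateSpace N p T :=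
  WithLp.toLp 2 (hf.toLp, hg.toLp)

lemma mkState_coeFn (x : StateSpace N p T) : mkState (Lp.memLp x.fst) (Lp.memLp x.snd) = x := by
  simp only [mkState, Lp.toLp_coeFn]
  rfl

lemma inner_mkState {f E : ℝ × Box N p → Vec N p} {g b : ℝ × Box N p → EuclideanSpace ℝ (Fin N)}
    (hf : MemLp f 2 (cyl N p T)) (hg : MemLp g 2 (cyl N p T))
    (hE : MemLp E 2 (cyl N p T)) (hb : MemLp b 2 (cyl N p T)) :
    inner ℝ (mkState hf hg) (mkState hE hb) =
      ∫ z, (inner ℝ (f z) (E z) + inner ℝ (g z) (b z)) ∂(cyl N p T) := by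
  rw [integral_add (integrable_inner_of_memLp hf hE) (integrable_inner_of_memLp hg hb),
    WithLp.prod_inner_apply]
  simp only [mkState, L2.inner_def]
  congr 1
  · refine integral_congr_ae ?_
    filter_upwards [hf.coeFn_toLp, hE.coeFn_toLp] with z h1 h2
    rw [h1, h2]
  · refine integral_congr_ae ?_
    filter_upwards [hg.coeFn_toLp, hb.coeFn_toLp] with z h1 h2
    rw [h1, h2]

lemma norm_sq_mkState {E : ℝ × Box N p → Vec N p} {b : ℝ × Box N p → EuclideanSpace ℝ (Fin N)}
    (hE : MemLp E 2 (cyl N p T)) (hb : MemLp b 2 (cyl N p T)) :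
    ‖mkState hE hb‖ ^ 2 =
      (∫ z, ‖E z‖ ^ 2 ∂(cyl N p T)) + ∫ z, ‖b z‖ ^ 2 ∂(cyl N p T) := by
  rw [← real_inner_self_eq_norm_sq, inner_mkState, integral_add (integrable_inner_of_memLp hE hE)
    (integrable_inner_of_memLp hb hb)]
  simp only [real_inner_self_eq_norm_sq]

/-- The vector `((𝔘 A)_i)_i` in Euclidean `ℝ^N`. -/
def opUVec (A : Mat N p) : EuclideanSpace ℝ (Fin N) := WithLp.toLp 2 (opU A)

lemma memLp_opUVec {q : ENNReal} {A : ℝ × Box N p → Mat N p}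
    (hA : ∀ a b, MemLp (fun z => A z a b) q (cyl N p T)) :
    MemLp (fun z => opUVec (A z)) q (cyl N p T) :=
  MemLp.of_eval_piLp fun i => memLp_opU hA i

lemma inner_opUVec (A : Mat N p) (b : EuclideanSpace ℝ (Fin N)) :
    inner ℝ (opUVec A) b = frob (opUadj b) A := by
  rw [frob_opUadj, PiLp.inner_apply]
  simp [opUVec]

lemma IsTestField.memLp_opL {Ψ : ℝ × Box N p → Mat N p} (hΨ : IsTestField Ψ) :
    MemLp (fun z : ℝ × Box N p => opL (fun x => Ψ (z.1, x)) z.2) 2 (cyl N p T) :=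
  (memLp_top_cyl_of_continuous T hΨ.continuous_opL).mono_exponent le_top

lemma IsTestField.memLp_opUVec_timeDeriv {Ψ : ℝ × Box N p → Mat N p} (hΨ : IsTestField Ψ) :
    MemLp (fun z => opUVec (timeDeriv Ψ z)) 2 (cyl N p T) :=
  memLp_opUVec fun a c =>
    (memLp_top_cyl_of_continuous T (hΨ.continuous_timeDeriv a c)).mono_exponent le_top

/-- The linear constraint for `(E, 𝔘* b)` is an orthogonality condition on the state `(E, b)`. -/
lemma linConstraint_iff_inner {E : ℝ × Box N p → Vec N p}
    {b : ℝ × Box N p → EuclideanSpace ℝ (Fin N)}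
    (hE : MemLp E 2 (cyl N p T)) (hb : MemLp b 2 (cyl N p T)) :
    LinConstraint T E (fun z => opUadj (b z)) ↔ ∀ Ψ : {Ψ : ℝ × Box N p → Mat N p // IsTestField Ψ},
      inner ℝ (mkState (T := T) Ψ.2.memLp_opL Ψ.2.memLp_opUVec_timeDeriv) (mkState hE hb) = 0 := by
  have key : ∀ (Ψ : ℝ × Box N p → Mat N p) (hΨ : IsTestField Ψ),
      inner ℝ (mkState (T := T) hΨ.memLp_opL hΨ.memLp_opUVec_timeDeriv) (mkState hE hb) =
        ∫ z, (frob (opUadj (b z)) (timeDeriv Ψ z) +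
          inner ℝ (E z) (opL (fun x => Ψ (z.1, x)) z.2)) ∂(cyl N p T) := by
    intro Ψ hΨ
    rw [inner_mkState]
    refine integral_congr_ae (Filter.Eventually.of_forall fun z => ?_)
    simp only [inner_opUVec]
    rw [real_inner_comm, add_comm]
  constructor
  · rintro h ⟨Ψ, hΨ⟩
    exact (key Ψ hΨ).trans (h Ψ hΨ)
  · intro h Ψ hΨ
    rw [← key Ψ hΨ]
    exact h ⟨Ψ, hΨ⟩

/-- The part of the Lagrangian that does not depend on the state. -/
def lagrangianConst (T : ℝ) (vbar v : ℝ × Box N p → Vec N p) : ℝ :=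
  ∫ z, ((1 / 2) * ‖vbar z‖ ^ 2 - inner ℝ (v z) (vbar z) + (1 / 2) * ‖v z‖ ^ 2) ∂(cyl N p T)

lemma memLp_two_of_top {v : ℝ × Box N p → Vec N p} (hv : MemLp v ⊤ (cyl N p T)) :
    MemLp v 2 (cyl N p T) := hv.mono_exponent le_top

lemma memLp_opUVec_tensorSq {v : ℝ × Box N p → Vec N p} (hv : MemLp v ⊤ (cyl N p T)) :
    MemLp (fun z => opUVec (tensorSq (v z))) 2 (cyl N p T) :=
  (memLp_opUVec (memLp_tensorSq_top hv)).mono_exponent le_top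

/-- For bounded `v`, the Lagrangian is a continuous affine function of the state. -/
lemma lagrangian_eq_inner {v0 : Box N p → Vec N p} {vbar E v : ℝ × Box N p → Vec N p}
    {b : ℝ × Box N p → EuclideanSpace ℝ (Fin N)}
    (hv0 : MemLp v0 2 volume) (hvbar : MemLp vbar 2 (cyl N p T)) (hE : MemLp E 2 (cyl N p T))
    (hb : MemLp b 2 (cyl N p T)) (hv : MemLp v ⊤ (cyl N p T)) :
    lagrangian T v0 vbar E (fun z => opUadj (b z)) v = lagrangianConst T vbar v +
      inner ℝ (mkState ((memLp_two_of_top hv).sub (memLp_comp_snd hv0)) (memLp_opUVec_tensorSq hv))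
        (mkState hE hb) := by
  have hv2 := memLp_two_of_top hv
  have hsq : ∀ {f : ℝ × Box N p → Vec N p}, MemLp f 2 (cyl N p T) →
      Integrable (fun z => ‖f z‖ ^ 2) (cyl N p T) :=
    fun hf => (memLp_two_iff_integrable_sq_norm hf.1).1 hf
  rw [inner_mkState, lagrangianConst, lagrangian]
  refine Eq.trans ?_ (integral_add ((((hsq hvbar).const_mul _).sub
      (integrable_inner_of_memLp hv2 hvbar)).add ((hsq hv2).const_mul _))
    ((integrable_inner_of_memLp (hv2.sub (memLp_comp_snd hv0)) hE).add
      (integrable_inner_of_memLp (memLp_opUVec_tensorSq hv) hb)))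
  refine integral_congr_ae (Filter.Eventually.of_forall fun z => ?_)
  simp only [baseIntegrand, quadIntegrand, frob_tensorSq_perturbed, inner_opUVec, Pi.sub_apply,
    inner_sub_left, inner_sub_right, real_inner_self_eq_norm_sq]
  ring

/-! ### Averages and the existence of an optimal pair -/

lemma norm_integral_sq_le {α F : Type*} [MeasurableSpace α] {μ : Measure α}
    [IsProbabilityMeasure μ] [NormedAddCommGroup F] [InnerProductSpace ℝ F] [CompleteSpace F]
    {f : α → F} (hf : MemLp f 2 μ) : ‖∫ x, f x ∂μ‖ ^ 2 ≤ ∫ x, ‖f x‖ ^ 2 ∂μ := by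
  set m := ∫ x, f x ∂μ
  have hi : Integrable f μ := hf.integrable (by norm_num)
  have hsq : Integrable (fun x => ‖f x‖ ^ 2) μ := (memLp_two_iff_integrable_sq_norm hf.1).1 hf
  have hin : Integrable (fun x => inner ℝ m (f x)) μ := hi.const_inner m
  have h1 : ∫ x, (2 * inner ℝ m (f x) - ‖m‖ ^ 2) ∂μ ≤ ∫ x, ‖f x‖ ^ 2 ∂μ := by
    refine integral_mono ((hin.const_mul 2).sub (integrable_const _)) hsq fun x => ?_
    have := sq_nonneg ‖m - f x‖
    rw [norm_sub_sq_real] at this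
    simp only
    linarith
  rw [integral_sub (hin.const_mul 2) (integrable_const _), integral_const_mul,
    integral_inner hi, real_inner_self_eq_norm_sq] at h1
  simp only [integral_const, probReal_univ, one_smul] at h1
  linarith

lemma memLp_slice {w : ℝ × Box N p → Vec N p} (hw : MemLp w 2 (cyl N p T)) :
    ∀ᵐ t ∂(volume.restrict (Set.Ioo 0 T)), MemLp (fun x => w (t, x)) 2 volume := by
  have h1 := (memLp_two_iff_integrable_sq_norm hw.1).1 hw
  have h2 := hw.1
  unfold cyl at h1 h2
  filter_upwards [h1.prod_right_ae, h2.prodMk_left] with t ht ht'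
  exact (memLp_two_iff_integrable_sq_norm ht').2 ht

lemma memLp_integral_slice {w : ℝ × Box N p → Vec N p} (hw : MemLp w 2 (cyl N p T)) :
    MemLp (fun t => ∫ y, w (t, y)) 2 (volume.restrict (Set.Ioo 0 T)) := by
  have h2 := hw.1
  have h1 := (memLp_two_iff_integrable_sq_norm hw.1).1 hw
  unfold cyl at h1 h2
  have hm := h2.integral_prod_right'
  rw [memLp_two_iff_integrable_sq_norm hm]
  refine h1.integral_prod_left.mono' (hm.norm.pow 2) ?_
  filter_upwards [memLp_slice hw] with t ht
  rw [Real.norm_of_nonneg (sq_nonneg _)]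
  exact norm_integral_sq_le ht

lemma memLp_avgT {w : ℝ × Box N p → Vec N p} (hw : MemLp w 2 (cyl N p T)) :
    MemLp (avgT w) 2 (cyl N p T) :=
  MemLp.comp_fst (memLp_integral_slice hw) (volume : Measure (Box N p))

/-- The averaging operator is the orthogonal projection onto the functions of time. -/
lemma integral_inner_avgT {e : ℝ → Vec N p} {w : ℝ × Box N p → Vec N p}
    (he : MemLp e 2 (volume.restrict (Set.Ioo 0 T))) (hw : MemLp w 2 (cyl N p T)) :
    ∫ z, inner ℝ (e z.1) (w z) ∂(cyl N p T) = ∫ z, inner ℝ (e z.1) (avgT w z) ∂(cyl N p T) := by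
  have he' : MemLp (fun z : ℝ × Box N p => e z.1) 2 (cyl N p T) :=
    MemLp.comp_fst he (volume : Measure (Box N p))
  have h1 := integrable_inner_of_memLp he' hw
  have h2 := integrable_inner_of_memLp he' (memLp_avgT hw)
  have h3 := memLp_slice hw
  unfold cyl at h1 h2 ⊢
  rw [integral_prod _ h1, integral_prod _ h2]
  refine integral_congr_ae ?_
  filter_upwards [h3] with t ht
  rw [integral_inner (ht.integrable (by norm_num))]
  simp [avgT, avg]

/-- The competitor `(Π v̄, 0)` of the dual problem. -/
lemma inDualClass_avgT {vbar : ℝ × Box N p → Vec N p} (hvbar : MemLp vbar 2 (cyl N p T)) :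
    InDualClass T (avgT vbar) fun _ => 0 :=
  ⟨memLp_avgT hvbar, fun _ _ => memLp_const _,
    Filter.Eventually.of_forall fun _ => Matrix.isSymm_zero⟩

lemma linConstraint_avgT {vbar : ℝ × Box N p → Vec N p} (hvbar : MemLp vbar 2 (cyl N p T)) :
    LinConstraint T (avgT vbar) fun _ => 0 := by
  intro Ψ hΨ
  have hL : avgT (fun z : ℝ × Box N p => opL (fun x => Ψ (z.1, x)) z.2) = 0 := by
    ext z a
    have hcont : Continuous fun x => opL (fun x => Ψ (z.1, x)) x :=
      hΨ.continuous_opL.comp (Continuous.prodMk_right z.1)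
    have hint : Integrable (fun x => opL (fun x => Ψ (z.1, x)) x) := by
      obtain ⟨C, hC⟩ := isCompact_univ.exists_bound_of_continuousOn hcont.continuousOn
      exact Integrable.of_bound hcont.aestronglyMeasurable C
        (Filter.Eventually.of_forall fun x => hC _ (Set.mem_univ _))
    simp only [avgT, avg]
    rw [eval_integral_piLp fun i => hint.eval_piLp i]
    exact hΨ.integral_opL_apply z.1 a
  have h := integral_inner_avgT (memLp_integral_slice hvbar) hΨ.memLp_opL
  rw [hL] at h
  simpa [frob, avgT, avg] using h

lemma functionalC_le_lagrangian {v0 : Box N p → Vec N p} {vbar v : ℝ × Box N p → Vec N p}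
    (hv0 : MemLp v0 2 volume) (hvbar : MemLp vbar 2 (cyl N p T)) (hv : MemLp v 2 (cyl N p T)) :
    functionalC T (avgT vbar) (avg v0) ≤ lagrangian T v0 vbar (avgT vbar) (fun _ => 0) v := by
  have hE := memLp_avgT hvbar
  have hu := memLp_comp_snd (T := T) hv0
  have hi1 : Integrable (fun z => -inner ℝ (v0 z.2) (avgT vbar z)) (cyl N p T) :=
    (integrable_inner_of_memLp hu hE).neg
  have hi2 := integrable_inner_of_memLp hE hvbar
  have hi3 := (integrable_inner_of_memLp hE hE).const_mul (1 / 2)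
  have havg : MemLp (fun z : ℝ × Box N p => avg v0 z.2) 2 (cyl N p T) := memLp_const _
  have h0 : ∫ z, inner ℝ (v0 z.2) (avgT vbar z) ∂(cyl N p T) =
      ∫ z, inner ℝ (avg v0 z.2) (avgT vbar z) ∂(cyl N p T) := by
    simp only [real_inner_comm (avgT vbar _)]
    exact integral_inner_avgT (memLp_integral_slice hvbar) hu
  have h1 : ∫ z, inner ℝ (avgT vbar z) (vbar z) ∂(cyl N p T) =
      ∫ z, inner ℝ (avgT vbar z) (avgT vbar z) ∂(cyl N p T) :=
    integral_inner_avgT (memLp_integral_slice hvbar) hvbar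
  have hi0 : Integrable (fun z => -inner ℝ (avg v0 z.2) (avgT vbar z)) (cyl N p T) :=
    (integrable_inner_of_memLp havg hE).neg
  have hi12 : Integrable (fun z => -inner ℝ (v0 z.2) (avgT vbar z) +
      inner ℝ (avgT vbar z) (vbar z)) (cyl N p T) := hi1.add hi2
  have h2 : functionalC T (avgT vbar) (avg v0) =
      ∫ z, ((-inner ℝ (v0 z.2) (avgT vbar z) + inner ℝ (avgT vbar z) (vbar z)) -
        1 / 2 * inner ℝ (avgT vbar z) (avgT vbar z)) ∂(cyl N p T) := by
    rw [functionalC, integral_add hi0 hi3, integral_sub hi12 hi3,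
      integral_add hi1 hi2, integral_neg, integral_neg, h0, h1,
      integral_const_mul]
    ring
  rw [h2]
  refine integral_mono (hi12.sub hi3) ((integrable_baseIntegrand hv0 hvbar hE).add
    (integrable_quadIntegrand hvbar hE (fun _ _ => memLp_const _) hv)) fun z => ?_
  simp only [baseIntegrand, quadIntegrand, frob_tensorSq_perturbed]
  have h3 := sq_nonneg ‖v z + (avgT vbar z - vbar z)‖
  rw [norm_add_sq_real, norm_sub_sq_real] at h3
  simp only [real_inner_self_eq_norm_sq]
  have h4 : frob (0 : Mat N p) (tensorSq (v z)) = 0 := by simp [frob]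
  rw [h4]
  linarith

/-- Existence of a pair whose Lagrangian has the largest possible infimum. -/
lemma exists_optimal_pair (hN : 1 < N) (hp : 1 ≤ p) {v0 : Box N p → Vec N p}
    {vbar : ℝ × Box N p → Vec N p}
    (hv0 : MemLp v0 2 volume) (hvbar : MemLp vbar 2 (cyl N p T)) :
    ∃ (E : ℝ × Box N p → Vec N p) (B : ℝ × Box N p → Mat N p) (c : ℝ), IsAdmissible T E B ∧
      (∀ v, MemLp v 2 (cyl N p T) → c ≤ lagrangian T v0 vbar E B v) ∧
      ∀ E' B', InDualClass T E' B' → LinConstraint T E' B' → ∀ d : ℝ,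
        (∀ v, MemLp v 2 (cyl N p T) → d ≤ lagrangian T v0 vbar E' B' v) → d ≤ c := by
  set g : {Ψ : ℝ × Box N p → Mat N p // IsTestField Ψ} → StateSpace N p T :=
    fun Ψ => mkState Ψ.2.memLp_opL Ψ.2.memLp_opUVec_timeDeriv
  set ι := {v : ℝ × Box N p → Vec N p // MemLp v ⊤ (cyl N p T)}
  set α : ι → ℝ := fun v => lagrangianConst T vbar v.1
  set h : ι → StateSpace N p T := fun v =>
    mkState ((memLp_two_of_top v.2).sub (memLp_comp_snd hv0)) (memLp_opUVec_tensorSq v.2)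
  -- Every competitor of the dual problem is represented by a state.
  have hrep : ∀ E B, InDualClass T E B → LinConstraint T E B → ∀ d : ℝ,
      (∀ v, MemLp v 2 (cyl N p T) → d ≤ lagrangian T v0 vbar E B v) →
      ∃ x, (∀ j, inner ℝ (g j) x = 0) ∧ ∀ i, d ≤ α i + inner ℝ (h i) x := by
    intro E B hEB hlin d hd
    set b : ℝ × Box N p → EuclideanSpace ℝ (Fin N) := fun z =>
      WithLp.toLp 2 fun i => 2 * B z (i, i, ⟨0, hp⟩) (i, i, ⟨0, hp⟩)
    have hb : MemLp b 2 (cyl N p T) := MemLp.of_eval_piLp fun i =>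
      ((hEB.memLp_B _ _).mono_exponent le_top).const_mul 2
    have hBb : ∀ᵐ z ∂(cyl N p T), B z = opUadj (b z) := hlin.ae_eq_opUadj hEB ⟨0, hp⟩
    have hlin' : LinConstraint T E fun z => opUadj (b z) := by
      intro Ψ hΨ
      rw [← hlin Ψ hΨ]
      refine integral_congr_ae ?_
      filter_upwards [hBb] with z hz
      rw [hz]
    refine ⟨mkState hEB.memLp_E hb, (linConstraint_iff_inner hEB.memLp_E hb).1 hlin', fun i => ?_⟩
    rw [← lagrangian_eq_inner hv0 hvbar hEB.memLp_E hb i.2, ← lagrangian_congr hBb]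
    exact hd _ (memLp_two_of_top i.2)
  -- Conversely, a state with a lower bound gives an admissible pair.
  have hadm : ∀ x : StateSpace N p T, (∀ j, inner ℝ (g j) x = 0) → ∀ c : ℝ,
      (∀ i, c ≤ α i + inner ℝ (h i) x) →
      (∀ᵐ z ∂(cyl N p T), ∀ i, |x.snd z i| ≤ 3) ∧
        IsAdmissible T x.fst (fun z => opUadj (x.snd z)) ∧
        ∀ v, MemLp v 2 (cyl N p T) →
          c ≤ lagrangian T v0 vbar x.fst (fun z => opUadj (x.snd z)) v := by
    intro x hx c hc
    have hE := Lp.memLp x.fst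
    have hb := Lp.memLp x.snd
    refine isAdmissible_of_le_lagrangian hN hp hv0 hvbar hE (fun i => hb.eval_piLp i) ?_ ?_
    · rw [linConstraint_iff_inner hE hb, mkState_coeFn]
      exact hx
    · intro v hv
      rw [lagrangian_eq_inner hv0 hvbar hE hb hv, mkState_coeFn]
      exact hc ⟨v, hv⟩
  obtain ⟨x₀, hx₀, hc₀⟩ := hrep _ _ (inDualClass_avgT hvbar) (linConstraint_avgT hvbar) _
    fun v hv => functionalC_le_lagrangian hv0 hvbar hv
  set Λ : ℝ := 1 + 6 * N * (p * (N + 1)) with hΛ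
  have hΛ0 : 0 < 8 * Λ := by positivity
  have hcoer : ∀ x : StateSpace N p T, (∀ j, inner ℝ (g j) x = 0) → ∀ c : ℝ,
      (∀ i, c ≤ α i + inner ℝ (h i) x) → ‖x‖ ^ 2 + 8 * Λ * c ≤
        8 * Λ * (∫ z, (2 * Λ * ‖v0 z.2‖ ^ 2 + ‖vbar z‖ ^ 2) ∂(cyl N p T)) +
          ∫ _z, (N * 9 : ℝ) ∂(cyl N p T) := by
    intro x hx c hc
    obtain ⟨hb3, hA, hlow⟩ := hadm x hx c hc
    have hE := Lp.memLp x.fst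
    have hb := Lp.memLp x.snd
    have h1 := coercivity hv0 hvbar hE (fun i => memLp_top_of_bound (hb.eval_piLp i).1 3 (by
      filter_upwards [hb3] with z hz using hz i)) hb3 hlow hΛ
    have h2 : ∫ z, ‖x.snd z‖ ^ 2 ∂(cyl N p T) ≤ ∫ _z, (N * 9 : ℝ) ∂(cyl N p T) := by
      refine integral_mono_ae ((memLp_two_iff_integrable_sq_norm hb.1).1 hb)
        (integrable_const _) ?_
      filter_upwards [hb3] with z hz
      rw [EuclideanSpace.norm_sq_eq]
      refine (Finset.sum_le_card_nsmul _ _ 9 fun i _ => ?_).trans (by simp)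
      rw [Real.norm_eq_abs]
      nlinarith [hz i, abs_nonneg (x.snd z i)]
    have h3 := norm_sq_mkState hE hb
    rw [mkState_coeFn] at h3
    linarith
  obtain ⟨x, c, hx, hc, hmax⟩ := exists_maximin g α h hΛ0 hcoer hx₀ hc₀
  obtain ⟨-, hA, hlow⟩ := hadm x hx c hc
  refine ⟨_, _, c, hA, hlow, fun E' B' hEB hlin d hd => ?_⟩
  obtain ⟨y, hy, hyd⟩ := hrep E' B' hEB hlin d hd
  exact hmax y hy d hyd

end NashDual

end

theorem theorem2p8 (N p : ℕ) (hN : 1 < N) (hp : 1 ≤ p) (T : ℝ) (hT : 0 < T)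
    (v0 : NashDual.Box N p → NashDual.Vec N p) (hv0 : MemLp v0 2 volume)
    (vbar : ℝ × NashDual.Box N p → NashDual.Vec N p)
    (hvbar : MemLp vbar 2 (NashDual.cyl N p T)) :
    (∃ (E : ℝ × NashDual.Box N p → NashDual.Vec N p)
        (B : ℝ × NashDual.Box N p → NashDual.Mat N p),
      NashDual.IsDualMaximizer T v0 vbar E B ∧
        NashDual.concaveObjective T v0 vbar E B = NashDual.dualValue T v0 vbar) ∧
      (NashDual.functionalC T (NashDual.avgT vbar) (NashDual.avg v0) : EReal) ≤
        NashDual.dualValue T v0 vbar ∧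
      NashDual.dualValue T v0 vbar < ⊤ := by
  open NashDual in
  obtain ⟨E, B, c, hadm, hlow, hmax⟩ := exists_optimal_pair hN hp hv0 hvbar
  have hobj_le : ∀ E' B', IsAdmissible T E' B' → concaveObjective T v0 vbar E' B' ≤ c := by
    intro E' B' h
    refine EReal.ge_of_forall_gt_iff_ge.1 fun d hd => EReal.coe_le_coe_iff.2 ?_
    exact hmax E' B' h.inClass h.constraint d ((le_concaveObjective_iff hv0 hvbar h d).1 hd.le)
  have hobj : concaveObjective T v0 vbar E B = c :=
    le_antisymm (hobj_le E B hadm) ((le_concaveObjective_iff hv0 hvbar hadm c).2 hlow)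
  have hval : dualValue T v0 vbar = c := by
    refine le_antisymm ?_ ?_
    · refine iSup_le fun E' => iSup_le fun B' => iSup_le fun h => ?_
      refine EReal.ge_of_forall_gt_iff_ge.1 fun d hd => EReal.coe_le_coe_iff.2 ?_
      exact hmax E' B' h.1 h.2 d ((le_dualTerm_iff hv0 hvbar h.1 d).1 hd.le)
    · exact ((le_dualTerm_iff hv0 hvbar hadm.inClass c).2 hlow).trans
        (le_iSup_of_le E (le_iSup_of_le B (le_iSup_of_le ⟨hadm.inClass, hadm.constraint⟩ le_rfl)))
  refine ⟨⟨E, B, ⟨hadm, fun E' B' h => hobj ▸ hobj_le E' B' h⟩, hobj.trans hval.symm⟩, ?_, ?_⟩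
  · rw [hval, EReal.coe_le_coe_iff]
    exact hmax _ _ (inDualClass_avgT hvbar) (linConstraint_avgT hvbar) _
      fun v hv => functionalC_le_lagrangian hv0 hvbar hv
  · rw [hval]
    exact EReal.coe_lt_top c
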